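/- **Theorem (Spectral comparison).** A weighted graph $(V,b,m)$ consists of a countably infinite set $V$, a symmetric map $b:V\times V\to[0,\infty)$ with zero diagonal and a map $m:V\to(0,\infty)$; $x,y\in V$ are neighbors if $b(x,y)>0$. All weighted graphs are assumed connected and locally finite (every vertex has only finitely many neighbors). Let $d$ be the combinatorial graph distance and, for $x_0\in V$ and $r\in\mathbb N_0$, let $S_r=\{x: d(x,x_0)=r\}$, $B_r=\bigcup_{i\le r}S_i$, $S_{-1}=\emptyset$, $$\kappa_\pm(x)=\frac1{m(x)}\sum_{y\in S_{r\pm1}}b(x,y)\quad (x\in S_r),\qquad V_1(r)=\sum_{x\in B_r}m(x),\qquad \partial B(r)=\sum_{x\in S_r}\kappa_+(x)m(x).$$ Let $\ell^2(V,m)$ be the Hilbert space of functions $f:V\to\mathbb R$ with $\sum_x f(x)^2m(x)<\infty$, with inner product $\langle f,g\rangle=\sum_x f(x)g(x)m(x)$. Let $Q(f,g)=\frac12\sum_{x,y}b(x,y)(f(x)-f(y))(g(x)-g(y))$, with domain $D(Q)$ the closure in $\ell^2(V,m)$ of the finitely supported functions with respect to $\langle\cdot,\cdot\rangle+Q(\cdot,\cdot)$,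 and let $L$ be the associated self-adjoint operator: $f\in D(L)$ with $Lf=g$ if and only if $f\in D(Q)$, $g\in\ell^2(V,m)$ and $Q(f,h)=\langle g,h\rangle$ for all $h\in D(Q)$. Write $\sigma(L)$ for its spectrum, $\lambda_0(L)=\inf\sigma(L)$, and $\sigma_{\mathrm{disc}}(L)$ for the set of isolated points of $\sigma(L)$ that are eigenvalues of finite multiplicity. Let $(V^{\mathrm{sym}},b^{\mathrm{sym}},m^{\mathrm{sym}})$ be a weakly spherically symmetric weighted graph with root $o$, that is, its curvatures $\kappa^{\mathrm{sym}}_\pm$ with respect to $o$ depend only on the distance to $o$; write $\kappa_\pm^{\mathrm{sym}}(r)$ for their value on the sphere of radius $r$ around $o$, and $L^{\mathrm{sym}}$ for its operator. A weighted graph $(V,b,m)$ has *stronger* (respectively *weaker*) *curvature growth* with respect to $x_0\in V$ than this graph if $m(x_0)=m^{\mathrm{sym}}(o)$ and, for all $r\in\mathbb N_0$ and $x\in S_r\subset V$, $\kappa_+(x)\ge\kappa_+^{\mathrm{sym}}(r)$ and $\kappa_-(x)\le\kappa_-^{\mathrm{sym}}(r)$ (respectively $\kappa_+(x)\le\kappa_+^{\mathrm{sym}}(r)$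 and $\kappa_-(x)\ge\kappa_-^{\mathrm{sym}}(r)$). If $(V,b,m)$ has stronger (respectively weaker) curvature growth than $(V^{\mathrm{sym}},b^{\mathrm{sym}},m^{\mathrm{sym}})$, then $$\lambda_0(L)\ge\lambda_0(L^{\mathrm{sym}})\qquad(\text{respectively }\lambda_0(L)\le\lambda_0(L^{\mathrm{sym}})).$$ If $(V^{\mathrm{sym}},b^{\mathrm{sym}},m^{\mathrm{sym}})$ satisfies $\sum_{r=0}^\infty \frac{V_1(r)}{\partial B(r)}=a<\infty$, where $V_1(r)$ and $\partial B(r)$ are those of this graph with respect to $o$, and $(V,b,m)$ has stronger curvature growth, then $$\lambda_0(L)\ge\frac1a\qquad\text{and}\qquad\sigma(L)=\sigma_{\mathrm{disc}}(L).$$ -/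

import Mathlib

noncomputable section

/-! ### Spectrum of an unbounded operator -/

namespace LinearPMap

variable {H : Type*} [NormedAddCommGroup H] [InnerProductSpace ℝ H]

/-- The resolvent set of an unbounded operator `T` on `H`: the numbers `μ` for which
`T - μ : D(T) → H` is a bijection with bounded inverse `R`. -/
def resolventSet (T : H →ₗ.[ℝ] H) : Set ℝ :=
  {μ | ∃ R : H →L[ℝ] H,
    (∀ f : T.domain, R (T f - μ • (f : H)) = f) ∧
    (∀ g : H, ∃ f : T.domain, R g = f ∧ T f - μ • (f : H) = g)}

/-- The spectrum of an unbounded operator. -/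
def spectrum (T : H →ₗ.[ℝ] H) : Set ℝ := T.resolventSetᶜ

/-- The kernel of `T - μ : D(T) → H`. -/
def eigenspace (T : H →ₗ.[ℝ] H) (μ : ℝ) : Submodule ℝ T.domain :=
  LinearMap.ker (T.toFun - μ • T.domain.subtype)

/-- The discrete spectrum: isolated points of the spectrum that are eigenvalues of finite
multiplicity. -/
def discreteSpectrum (T : H →ₗ.[ℝ] H) : Set ℝ :=
  {μ | μ ∈ T.spectrum ∧
    (∃ ε > 0, ∀ ν ∈ T.spectrum, |ν - μ| < ε → ν = μ) ∧
    T.eigenspace μ ≠ ⊥ ∧ FiniteDimensional ℝ (T.eigenspace μ)}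

/-- The infimum of the spectrum, as an extended real number. -/
def bottomOfSpectrum (T : H →ₗ.[ℝ] H) : EReal := ⨅ μ ∈ T.spectrum, (μ : EReal)

end LinearPMap

/-! ### Weighted graphs -/

/-- A connected, locally finite weighted graph `(V, b, m)` (without killing term) with edge weights
`b` and vertex measure `m`; `x` and `y` are neighbors when `0 < b x y`. -/
structure WeightedGraph (V : Type*) where
  b : V → V → ℝ
  m : V → ℝ
  b_nonneg : ∀ x y, 0 ≤ b x y
  b_symm : ∀ x y, b x y = b y x
  b_self : ∀ x, b x x = 0
  m_pos : ∀ x, 0 < m x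
  locallyFinite : ∀ x, {y | 0 < b x y}.Finite
  connected : ∀ x y, Relation.ReflTransGen (fun u v => 0 < b u v) x y

namespace WeightedGraph

variable {V : Type*} (G : WeightedGraph V)

/-- The underlying combinatorial graph. -/
def graph : SimpleGraph V where
  Adj x y := 0 < G.b x y
  symm := ⟨fun x y h => by rwa [G.b_symm y x]⟩
  loopless := ⟨fun x h => by simp [G.b_self x] at h⟩

/-- The combinatorial distance. -/
def dist (x y : V) : ℕ := G.graph.dist x y

/-- The sphere `S_r(x₀)`. -/
def sphere (x₀ : V) (r : ℕ) : Set V := {x | G.dist x x₀ = r}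

/-- The ball `B_r(x₀)`. -/
def ball (x₀ : V) (r : ℕ) : Set V := {x | G.dist x x₀ ≤ r}

/-- The outer curvature `κ₊` with respect to `x₀`. -/
def outerCurvature (x₀ x : V) : ℝ :=
  1 / G.m x * ∑' y : {y : V // G.dist y x₀ = G.dist x x₀ + 1}, G.b x y

/-- The inner curvature `κ₋` with respect to `x₀`. -/
def innerCurvature (x₀ x : V) : ℝ :=
  1 / G.m x * ∑' y : {y : V // G.dist y x₀ + 1 = G.dist x x₀}, G.b x y

/-- A function is spherically symmetric with respect to `x₀` if its values depend only on the
distance to `x₀`. -/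
def SphericallySymmetric (x₀ : V) (f : V → ℝ) : Prop :=
  ∃ g : ℕ → ℝ, ∀ x, f x = g (G.dist x x₀)

/-- `G` is weakly spherically symmetric with root `o`. -/
def WeaklySphericallySymmetric (o : V) : Prop :=
  G.SphericallySymmetric o (G.outerCurvature o) ∧ G.SphericallySymmetric o (G.innerCurvature o)

/-- `G` has stronger curvature growth with respect to `x₀` than `Gs` (with root `o`). -/
def StrongerCurvatureGrowth (x₀ : V) {W : Type*} (Gs : WeightedGraph W) (o : W) : Prop :=
  G.m x₀ = Gs.m o ∧ ∀ r : ℕ, ∀ x ∈ G.sphere x₀ r, ∀ y ∈ Gs.sphere o r,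
    Gs.outerCurvature o y ≤ G.outerCurvature x₀ x ∧
    G.innerCurvature x₀ x ≤ Gs.innerCurvature o y

/-- `G` has weaker curvature growth with respect to `x₀` than `Gs` (with root `o`). -/
def WeakerCurvatureGrowth (x₀ : V) {W : Type*} (Gs : WeightedGraph W) (o : W) : Prop :=
  G.m x₀ = Gs.m o ∧ ∀ r : ℕ, ∀ x ∈ G.sphere x₀ r, ∀ y ∈ Gs.sphere o r,
    G.outerCurvature x₀ x ≤ Gs.outerCurvature o y ∧
    Gs.innerCurvature o y ≤ G.innerCurvature x₀ x

/-- The volume `V₁(r) = m(B_r)` of a ball. -/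
def ballVolume (x₀ : V) (r : ℕ) : ℝ := ∑' x : G.ball x₀ r, G.m x

/-- The measure `∂B(r) = ∑_{x ∈ S_r} κ₊(x) m(x)` of the boundary of a ball. -/
def ballBoundary (x₀ : V) (r : ℕ) : ℝ :=
  ∑' x : G.sphere x₀ r, G.outerCurvature x₀ x * G.m x

/-! ### The Hilbert space `ℓ²(V, m)` -/

/-- Square summable functions with respect to the measure `m`. -/
def squareSummable : Submodule ℝ (V → ℝ) where
  carrier := {f | Summable fun x => f x ^ 2 * G.m x}
  zero_mem' := by simp
  add_mem' := by
    intro f g hf hg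
    refine Summable.of_nonneg_of_le (fun x => ?_) (fun x => ?_) ((hf.mul_left 2).add (hg.mul_left 2))
    · exact mul_nonneg (sq_nonneg _) (G.m_pos x).le
    · have := mul_nonneg (sq_nonneg (f x - g x)) (G.m_pos x).le
      simp only [Pi.add_apply]
      nlinarith
  smul_mem' := by
    intro c f hf
    refine (hf.mul_left (c ^ 2)).congr fun x => ?_
    simp only [Pi.smul_apply, smul_eq_mul]
    ring

/-- The space `ℓ²(V, m)`. -/
def L2 : Type _ := G.squareSummable

instance : AddCommGroup G.L2 := inferInstanceAs (AddCommGroup G.squareSummable)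

instance : Module ℝ G.L2 := inferInstanceAs (Module ℝ G.squareSummable)

instance : CoeFun G.L2 (fun _ => V → ℝ) := ⟨fun f => f.1⟩

variable {G}

@[simp] lemma L2.add_apply (f g : G.L2) (x : V) : (f + g) x = f x + g x := rfl

@[simp] lemma L2.sub_apply (f g : G.L2) (x : V) : (f - g) x = f x - g x := rfl

@[simp] lemma L2.smul_apply (c : ℝ) (f : G.L2) (x : V) : (c • f) x = c * f x := rfl

@[simp] lemma L2.zero_apply (x : V) : (0 : G.L2) x = 0 := rfl

lemma L2.ext {f g : G.L2} (h : ∀ x, f x = g x) : f = g := Subtype.ext (funext h)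

lemma L2.summable_sq (f : G.L2) : Summable fun x => f x ^ 2 * G.m x := f.2

lemma L2.summable_mul (f g : G.L2) : Summable fun x => f x * g x * G.m x := by
  refine Summable.of_norm_bounded (f.summable_sq.add g.summable_sq) fun x => ?_
  have hm := (G.m_pos x).le
  rw [Real.norm_eq_abs, abs_le]
  constructor <;>
    nlinarith [mul_nonneg (sq_nonneg (f x - g x)) hm, mul_nonneg (sq_nonneg (f x + g x)) hm,
      mul_nonneg (sq_nonneg (f x)) hm, mul_nonneg (sq_nonneg (g x)) hm]

variable (G)

/-- The inner product `⟨f, g⟩ = ∑ f(x) g(x) m(x)`. -/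
@[reducible] def L2.core : InnerProductSpace.Core ℝ G.L2 where
  inner f g := ∑' x, f x * g x * G.m x
  conj_inner_symm f g := by
    simp only [conj_trivial]
    exact tsum_congr fun x => by ring
  re_inner_nonneg f := by
    simp only [RCLike.re_to_real]
    exact tsum_nonneg fun x => mul_nonneg (mul_self_nonneg _) (G.m_pos x).le
  add_left f g h := by
    rw [← (L2.summable_mul f h).tsum_add (L2.summable_mul g h)]
    exact tsum_congr fun x => by simp only [L2.add_apply]; ring
  smul_left f g c := by
    simp only [conj_trivial]
    rw [← tsum_mul_left]
    exact tsum_congr fun x => by simp only [L2.smul_apply]; ring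
  definite f hf := by
    have h0 : ∀ x, 0 ≤ f x * f x * G.m x :=
      fun x => mul_nonneg (mul_self_nonneg _) (G.m_pos x).le
    have h1 := (hasSum_zero_iff_of_nonneg h0).1 (hf ▸ (L2.summable_mul f f).hasSum)
    refine L2.ext fun x => ?_
    have h2 := congrFun h1 x
    simpa [(G.m_pos x).ne'] using h2

instance : NormedAddCommGroup G.L2 := (L2.core G).toNormedAddCommGroup

instance : InnerProductSpace ℝ G.L2 := InnerProductSpace.ofCore (L2.core G).toCore

lemma L2.inner_def (f g : G.L2) : inner ℝ f g = ∑' x, f x * g x * G.m x := rfl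

/-! ### The Dirichlet form and the Laplacian -/

/-- `f` has finite energy: the double series defining `Q(f, f)` converges. -/
def FiniteEnergy (f : V → ℝ) : Prop :=
  Summable fun p : V × V => G.b p.1 p.2 * (f p.1 - f p.2) ^ 2

/-- The form `Q(f, g) = 1/2 ∑ b(x, y) (f(x) - f(y)) (g(x) - g(y))`. -/
def energy (f g : V → ℝ) : ℝ :=
  1 / 2 * ∑' p : V × V, G.b p.1 p.2 * (f p.1 - f p.2) * (g p.1 - g p.2)

variable {G}

lemma FiniteEnergy.summable_mul {f g : V → ℝ} (hf : G.FiniteEnergy f) (hg : G.FiniteEnergy g) :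
    Summable fun p : V × V => G.b p.1 p.2 * (f p.1 - f p.2) * (g p.1 - g p.2) := by
  refine Summable.of_norm_bounded (Summable.add hf hg) fun p => ?_
  have hb := G.b_nonneg p.1 p.2
  rw [Real.norm_eq_abs, abs_le]
  constructor <;>
    nlinarith [mul_nonneg hb (sq_nonneg ((f p.1 - f p.2) - (g p.1 - g p.2))),
      mul_nonneg hb (sq_nonneg ((f p.1 - f p.2) + (g p.1 - g p.2))),
      mul_nonneg hb (sq_nonneg (f p.1 - f p.2)), mul_nonneg hb (sq_nonneg (g p.1 - g p.2))]

lemma FiniteEnergy.add {f g : V → ℝ} (hf : G.FiniteEnergy f) (hg : G.FiniteEnergy g) :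
    G.FiniteEnergy (fun x => f x + g x) := by
  have h := ((Summable.add hf hg).add ((hf.summable_mul hg).mul_left 2))
  refine h.congr fun p => ?_
  ring

lemma FiniteEnergy.smul {f : V → ℝ} (hf : G.FiniteEnergy f) (c : ℝ) :
    G.FiniteEnergy (fun x => c * f x) :=
  (hf.mul_left (c ^ 2)).congr fun p => by ring

lemma FiniteEnergy.sub {f g : V → ℝ} (hf : G.FiniteEnergy f) (hg : G.FiniteEnergy g) :
    G.FiniteEnergy (fun x => f x - g x) := by
  simpa [sub_eq_add_neg] using hf.add (hg.smul (-1))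

lemma energy_add_left {f g h : V → ℝ} (hf : G.FiniteEnergy f) (hg : G.FiniteEnergy g)
    (hh : G.FiniteEnergy h) :
    G.energy (fun x => f x + g x) h = G.energy f h + G.energy g h := by
  unfold energy
  rw [← mul_add, ← (hf.summable_mul hh).tsum_add (hg.summable_mul hh)]
  congr 1
  exact tsum_congr fun p => by ring

lemma energy_smul_left (c : ℝ) (f h : V → ℝ) :
    G.energy (fun x => c * f x) h = c * G.energy f h := by
  unfold energy
  rw [mul_left_comm, ← tsum_mul_left (a := c)]
  congr 1
  exact tsum_congr fun p => by ring

lemma energy_self_smul (c : ℝ) (f : V → ℝ) :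
    G.energy (fun x => c * f x) (fun x => c * f x) = c ^ 2 * G.energy f f := by
  unfold energy
  rw [mul_left_comm, ← tsum_mul_left (a := c ^ 2)]
  congr 1
  exact tsum_congr fun p => by ring

lemma energy_self_nonneg (f : V → ℝ) : 0 ≤ G.energy f f := by
  unfold energy
  refine mul_nonneg (by norm_num) (tsum_nonneg fun p => ?_)
  rw [mul_assoc]
  exact mul_nonneg (G.b_nonneg _ _) (mul_self_nonneg _)

lemma energy_add_self_le {f g : V → ℝ} (hf : G.FiniteEnergy f) (hg : G.FiniteEnergy g) :
    G.energy (fun x => f x + g x) (fun x => f x + g x)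
      ≤ 2 * G.energy f f + 2 * G.energy g g := by
  unfold energy
  have h1 := (hf.summable_mul hf).mul_left 2
  have h2 := (hg.summable_mul hg).mul_left 2
  have h3 := (hf.add hg).summable_mul (hf.add hg)
  have h := Summable.tsum_le_tsum (fun p : V × V => ?_) h3 (h1.add h2)
  · rw [h1.tsum_add h2, tsum_mul_left, tsum_mul_left] at h
    linarith
  · nlinarith [mul_nonneg (G.b_nonneg p.1 p.2) (sq_nonneg ((f p.1 - f p.2) - (g p.1 - g p.2)))]

lemma finiteEnergy_single [DecidableEq V] (x : V) (c : ℝ) :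
    G.FiniteEnergy (Pi.single x c) := by
  refine summable_of_hasFiniteSupport ?_
  refine Set.Finite.subset (((G.locallyFinite x).image fun y => (x, y)).union
    ((G.locallyFinite x).image fun y => (y, x))) ?_
  rintro ⟨u, v⟩ h
  rw [Function.mem_support] at h
  have hb : 0 < G.b u v := lt_of_le_of_ne (G.b_nonneg u v) fun h0 => h (by simp [← h0])
  by_cases hu : u = x
  · subst hu
    exact Or.inl ⟨v, hb, rfl⟩
  by_cases hv : v = x
  · subst hv
    exact Or.inr ⟨u, by rwa [Set.mem_ofPred_eq, G.b_symm], rfl⟩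
  exact absurd (by simp [hu, hv]) h

lemma finiteEnergy_of_finite_support {f : V → ℝ} (hf : (Function.support f).Finite) :
    G.FiniteEnergy f := by
  classical
  have key : ∀ s : Finset V,
      G.FiniteEnergy (fun y => ∑ x ∈ s, Pi.single (M := fun _ => ℝ) x (f x) y) := by
    intro s
    induction s using Finset.induction_on with
    | empty => simp [FiniteEnergy]
    | insert a s ha ih =>
      simp only [Finset.sum_insert ha]
      exact (finiteEnergy_single a (f a)).add ih
  convert key hf.toFinset using 2 with y
  simp only [Pi.single_apply, Finset.sum_ite_eq, Set.Finite.mem_toFinset, Function.mem_support]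
  split_ifs with h
  · rfl
  · simpa using h

variable (G)

/-- The domain `D(Q)`: the closure of the finitely supported functions in `ℓ²(V, m)` with respect to
the norm `(‖f‖² + Q(f, f))^{1/2}`. -/
def formDomain : Submodule ℝ G.L2 where
  carrier := {f | G.FiniteEnergy f ∧ ∀ ε > 0, ∃ φ : G.L2, (Function.support φ).Finite ∧
    ‖f - φ‖ ^ 2 + G.energy (fun x => f x - φ x) (fun x => f x - φ x) < ε}
  zero_mem' := by
    refine ⟨by simp [FiniteEnergy], fun ε hε => ⟨0, ?_, ?_⟩⟩
    · simp [Function.support]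
    · simpa [energy] using hε
  add_mem' := by
    rintro f g ⟨hf, hf'⟩ ⟨hg, hg'⟩
    refine ⟨hf.add hg, fun ε hε => ?_⟩
    obtain ⟨φ, hφ, h1⟩ := hf' (ε / 2 / 2) (by linarith)
    obtain ⟨ψ, hψ, h2⟩ := hg' (ε / 2 / 2) (by linarith)
    refine ⟨φ + ψ, (hφ.union hψ).subset (Function.support_add _ _), ?_⟩
    have e1 := energy_add_self_le (hf.sub (finiteEnergy_of_finite_support hφ))
      (hg.sub (finiteEnergy_of_finite_support hψ))
    have e2 : (f + g - (φ + ψ)) = (f - φ) + (g - ψ) := by abel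
    have e3 : ‖(f - φ) + (g - ψ)‖ ^ 2 ≤ 2 * ‖f - φ‖ ^ 2 + 2 * ‖g - ψ‖ ^ 2 := by
      have := norm_add_le (f - φ) (g - ψ)
      nlinarith [norm_nonneg ((f - φ) + (g - ψ)), sq_nonneg (‖f - φ‖ - ‖g - ψ‖)]
    have e4 : (fun x => (f + g) x - (φ + ψ) x) = fun x => (f x - φ x) + (g x - ψ x) := by
      funext x
      simp only [L2.add_apply]
      ring
    rw [e4, e2]
    linarith
  smul_mem' := by
    rintro c f ⟨hf, hf'⟩
    refine ⟨hf.smul c, fun ε hε => ?_⟩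
    have hc : 0 < c ^ 2 + 1 := by positivity
    obtain ⟨φ, hφ, h1⟩ := hf' (ε / (c ^ 2 + 1)) (by positivity)
    refine ⟨c • φ, hφ.subset (Function.support_const_smul_subset c φ), ?_⟩
    have e4 : (fun x => (c • f) x - (c • φ) x) = fun x => c * (f x - φ x) := by
      funext x
      simp only [L2.smul_apply]
      ring
    rw [e4, energy_self_smul, ← smul_sub, norm_smul, mul_pow, Real.norm_eq_abs, sq_abs]
    rw [lt_div_iff₀ hc] at h1
    nlinarith [sq_nonneg ‖f - φ‖, energy_self_nonneg (G := G) (fun x => f x - φ x)]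

variable {G}

lemma mem_formDomain_of_finite_support {φ : G.L2} (hφ : (Function.support φ).Finite) :
    φ ∈ G.formDomain :=
  ⟨finiteEnergy_of_finite_support hφ, fun ε hε => ⟨φ, hφ, by simpa [energy] using hε⟩⟩

variable (G)

/-- The graph of the operator associated with the closed form `Q`: pairs `(f, g)` with `f ∈ D(Q)`,
`g ∈ ℓ²(V, m)` and `Q(f, h) = ⟨g, h⟩` for all `h ∈ D(Q)`. -/
def laplacianGraph : Submodule ℝ (G.L2 × G.L2) where
  carrier := {p | p.1 ∈ G.formDomain ∧ ∀ h ∈ G.formDomain, G.energy p.1 h = inner ℝ p.2 h}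
  zero_mem' := ⟨G.formDomain.zero_mem, fun h _ => by simp [energy]⟩
  add_mem' := by
    rintro ⟨f, f'⟩ ⟨g, g'⟩ ⟨hf, hf'⟩ ⟨hg, hg'⟩
    refine ⟨G.formDomain.add_mem hf hg, fun h hh => ?_⟩
    have := energy_add_left hf.1 hg.1 hh.1
    rw [hf' h hh, hg' h hh, ← inner_add_left] at this
    exact this
  smul_mem' := by
    rintro c ⟨f, f'⟩ ⟨hf, hf'⟩
    refine ⟨G.formDomain.smul_mem c hf, fun h hh => ?_⟩
    have := energy_smul_left (G := G) c f h
    rw [hf' h hh] at this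
    refine this.trans ?_
    simp [inner_smul_left]

/-- The relation `laplacianGraph` is single-valued. -/
lemma laplacianGraph_single_valued (p : G.L2 × G.L2) (hp : p ∈ G.laplacianGraph)
    (h0 : p.1 = 0) : p.2 = 0 := by
  classical
  refine L2.ext fun x => ?_
  have hs : (Function.support (Pi.single (M := fun _ => ℝ) x (1 : ℝ))).Finite :=
    (Set.finite_singleton x).subset Pi.support_single_subset
  let δ : G.L2 := ⟨Pi.single x 1, summable_of_hasFiniteSupport (hs.subset fun y hy => by
    rw [Function.mem_support] at hy ⊢
    exact fun h => hy (by simp [h]))⟩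
  have h1 := hp.2 δ (mem_formDomain_of_finite_support hs)
  rw [h0, L2.inner_def, tsum_eq_single x] at h1
  · have h2 : δ x = 1 := Pi.single_eq_same x 1
    rw [h2] at h1
    simpa [energy, (G.m_pos x).ne'] using h1.symm
  · intro y hy
    have h2 : δ y = 0 := Pi.single_eq_of_ne hy 1
    simp [h2]

/-- The Laplacian `L` on `ℓ²(V, m)`: the self-adjoint operator associated with `Q`, with
`Q(f, h) = ⟨L f, h⟩` for `f ∈ D(L)` and `h ∈ D(Q)`. -/
def laplacian : G.L2 →ₗ.[ℝ] G.L2 := G.laplacianGraph.toLinearPMap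

lemma laplacian_graph : G.laplacian.graph = G.laplacianGraph :=
  Submodule.toLinearPMap_graph_eq _ G.laplacianGraph_single_valued

end WeightedGraph

end

noncomputable section

open Filter Topology

namespace WeightedGraph

section

variable {V : Type*} (G : WeightedGraph V)

/-! ### Balls and spheres -/

/-! By the variational principle, `λ₀(L)` is the largest `c` with `Q(φ,φ) ≥ c‖φ‖²` for all finitely
supported `φ`. A positive `f` with `Lf ≥ w f` proves `Q(φ,φ) ≥ ∑ w φ² m` (`tsum_weight_le_energy`),
so spectral bounds reduce to finding positive supersolutions, and radial ones can be carried from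
one graph to another.

Let `g` solve the radial equation `Lg = c g` for a curvature profile `κ±(r)`. While `g` is positive
it is decreasing, so raising `κ₊` and lowering `κ₋` can only increase `Lg`. On the graph of stronger
curvature a positive `g` is therefore a supersolution and `c ≤ λ₀` (`weight_le_energy_of_radial`).
On the graph of weaker curvature it is a subsolution: if it failed to be positive, its truncation
would have Rayleigh quotient at most `c`, which is impossible for `c < λ₀`
(`radialSolution_pos_of_formBoundedBelow`). Together these give the comparison in both directions.

If `∑ V₁(r)/∂B(r) = a`, the tails of the series form a radial `g` with `Lg = 1`, `g ≤ a` and `g →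
0`. On a graph of stronger curvature this gives a Hardy inequality with weight `1/g`. The bound `1/g
≥ 1/a` yields `λ₀ ≥ 1/a`. As `1/g → ∞`, functions of bounded energy are uniformly small off finite
sets (`EnergyTight`), so `L⁻¹` is compact and the spectrum is discrete. -/

lemma graph_connected (x₀ : V) : G.graph.Connected :=
  haveI : Nonempty V := ⟨x₀⟩
  ⟨fun x y => (SimpleGraph.reachable_iff_reflTransGen x y).2 (G.connected x y)⟩

lemma dist_root (x₀ : V) : G.dist x₀ x₀ = 0 := SimpleGraph.dist_self

lemma dist_le_succ (x₀ : V) {x y : V} (h : 0 < G.b x y) : G.dist y x₀ ≤ G.dist x x₀ + 1 := by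
  have h1 := (G.graph_connected x₀).dist_triangle (u := y) (v := x) (w := x₀)
  have h2 : G.graph.dist y x = 1 := SimpleGraph.dist_eq_one_iff_adj.2
    (show 0 < G.b y x by rwa [G.b_symm])
  unfold dist
  omega

lemma exists_neighbor_closer {x₀ x : V} {n : ℕ} (h : G.dist x x₀ = n + 1) :
    ∃ y, 0 < G.b x y ∧ G.dist y x₀ = n := by
  obtain ⟨p, hp⟩ := (G.graph_connected x₀).exists_walk_length_eq_dist x x₀
  change p.length = G.dist x x₀ at hp
  cases p with
  | nil => simp [h] at hp
  | cons hadj q =>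
    rename_i y
    refine ⟨y, hadj, le_antisymm ?_ ?_⟩
    · have := SimpleGraph.dist_le q
      simp only [SimpleGraph.Walk.length_cons] at hp
      unfold dist at *
      omega
    · have := G.dist_le_succ x₀ (x := y) (y := x) (by rw [G.b_symm]; exact hadj)
      omega

lemma ball_finite (x₀ : V) (r : ℕ) : (G.ball x₀ r).Finite := by
  induction r with
  | zero =>
    refine (Set.finite_singleton x₀).subset fun x hx => ?_
    have h0 : G.graph.dist x x₀ = 0 := Nat.le_zero.1 hx
    exact ((G.graph_connected x₀).dist_eq_zero_iff).1 h0
  | succ r ih =>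
    refine (ih.union (ih.biUnion fun y _ => G.locallyFinite y)).subset fun x hx => ?_
    rcases Nat.lt_or_ge r (G.dist x x₀) with h | h
    · have hx' : G.dist x x₀ = r + 1 := le_antisymm hx h
      obtain ⟨y, hy, hyr⟩ := G.exists_neighbor_closer hx'
      refine Or.inr (Set.mem_biUnion (x := y) hyr.le ?_)
      change 0 < G.b y x
      rwa [G.b_symm]
    · exact Or.inl h

lemma sphere_finite (x₀ : V) (r : ℕ) : (G.sphere x₀ r).Finite :=
  (G.ball_finite x₀ r).subset fun _ hx => le_of_eq hx

/-- Balls are finite, so some vertex lies beyond radius `r`, and a geodesic from it to the root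
crosses every smaller sphere. -/
lemma sphere_nonempty [Infinite V] (x₀ : V) (r : ℕ) : (G.sphere x₀ r).Nonempty := by
  have key : ∀ n : ℕ, ∀ x, G.dist x x₀ = r + n → (G.sphere x₀ r).Nonempty := by
    intro n
    induction n with
    | zero => exact fun x hx => ⟨x, hx⟩
    | succ n ih =>
      intro x hx
      obtain ⟨y, -, hy⟩ := G.exists_neighbor_closer (n := r + n) hx
      exact ih y hy
  obtain ⟨x, hx⟩ := (G.ball_finite x₀ r).exists_notMem
  have hx' : r < G.dist x x₀ := not_le.1 hx
  exact key (G.dist x x₀ - r) x (by omega)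

/-! ### Sums over neighbors -/

lemma hasFiniteSupport_b_mul (x : V) (F : V → ℝ) :
    Function.HasFiniteSupport fun y => G.b x y * F y := by
  refine (G.locallyFinite x).subset fun y hy => ?_
  exact lt_of_le_of_ne (G.b_nonneg x y) fun h => hy (by simp [← h])

lemma summable_b_mul (x : V) (F : V → ℝ) : Summable fun y => G.b x y * F y :=
  summable_of_hasFiniteSupport (G.hasFiniteSupport_b_mul x F)

lemma mul_outerCurvature (x₀ x : V) :
    G.m x * G.outerCurvature x₀ x =
      ∑' y, G.b x y * Set.indicator {y | G.dist y x₀ = G.dist x x₀ + 1} 1 y := by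
  have h : (fun y => G.b x y * Set.indicator {y | G.dist y x₀ = G.dist x x₀ + 1} 1 y) =
      Set.indicator {y | G.dist y x₀ = G.dist x x₀ + 1} (G.b x) := by
    funext y
    by_cases hy : y ∈ {y | G.dist y x₀ = G.dist x x₀ + 1} <;> simp [hy]
  rw [h, ← tsum_subtype, outerCurvature, ← mul_assoc, mul_one_div_cancel (G.m_pos x).ne', one_mul]
  rfl

lemma mul_innerCurvature (x₀ x : V) :
    G.m x * G.innerCurvature x₀ x =
      ∑' y, G.b x y * Set.indicator {y | G.dist y x₀ + 1 = G.dist x x₀} 1 y := by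
  have h : (fun y => G.b x y * Set.indicator {y | G.dist y x₀ + 1 = G.dist x x₀} 1 y) =
      Set.indicator {y | G.dist y x₀ + 1 = G.dist x x₀} (G.b x) := by
    funext y
    by_cases hy : y ∈ {y | G.dist y x₀ + 1 = G.dist x x₀} <;> simp [hy]
  rw [h, ← tsum_subtype, innerCurvature, ← mul_assoc, mul_one_div_cancel (G.m_pos x).ne', one_mul]
  rfl

lemma outerCurvature_nonneg (x₀ x : V) : 0 ≤ G.outerCurvature x₀ x :=
  mul_nonneg (one_div_pos.2 (G.m_pos x)).le (tsum_nonneg fun _ => G.b_nonneg _ _)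

lemma innerCurvature_nonneg (x₀ x : V) : 0 ≤ G.innerCurvature x₀ x :=
  mul_nonneg (one_div_pos.2 (G.m_pos x)).le (tsum_nonneg fun _ => G.b_nonneg _ _)

lemma outerCurvature_pos_of_edge {x₀ x y : V} (h : 0 < G.b x y)
    (hy : G.dist y x₀ = G.dist x x₀ + 1) : 0 < G.outerCurvature x₀ x := by
  have h1 : 0 < G.m x * G.outerCurvature x₀ x := by
    rw [mul_outerCurvature]
    refine (G.summable_b_mul x _).tsum_pos (fun z => mul_nonneg (G.b_nonneg _ _)
      (Set.indicator_nonneg (fun _ _ => zero_le_one) _)) y ?_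
    simp [hy, h]
  exact pos_of_mul_pos_right h1 (G.m_pos x).le

/-! ### The formal Laplacian -/

/-- The formal Laplacian multiplied by the measure: `x ↦ ∑ b(x, y) (f(x) - f(y))`. -/
def flow (f : V → ℝ) (x : V) : ℝ := ∑' y, G.b x y * (f x - f y)

/-- Neighbors lie in the same or an adjacent sphere, and those in the same sphere contribute zero.
At the root the truncated index `0 - 1 = 0` makes the inner term vanish, as it should. -/
lemma flow_radial (x₀ : V) (g : ℕ → ℝ) (x : V) :
    G.flow (fun x => g (G.dist x x₀)) x =
      G.m x * (G.outerCurvature x₀ x * (g (G.dist x x₀) - g (G.dist x x₀ + 1)) +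
        G.innerCurvature x₀ x * (g (G.dist x x₀) - g (G.dist x x₀ - 1))) := by
  rw [mul_add, ← mul_assoc, ← mul_assoc, mul_outerCurvature, mul_innerCurvature, ← tsum_mul_right,
    ← tsum_mul_right, ← Summable.tsum_add ((G.summable_b_mul x _).mul_right _)
      ((G.summable_b_mul x _).mul_right _)]
  refine tsum_congr fun y => ?_
  rcases (G.b_nonneg x y).eq_or_lt with h | h
  · simp [← h]
  have h1 := G.dist_le_succ x₀ h
  have h2 := G.dist_le_succ x₀ (x := y) (y := x) (by rwa [G.b_symm])
  obtain h3 | h3 | h3 : G.dist y x₀ = G.dist x x₀ + 1 ∨ G.dist y x₀ = G.dist x x₀ ∨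
    G.dist y x₀ + 1 = G.dist x x₀ := by omega
  · simp [Set.indicator, h3]
    omega
  · simp [Set.indicator, h3]
  · simp [Set.indicator, ← h3]
    omega

/-- Green's formula. -/
lemma energy_eq_tsum_flow (f : V → ℝ) {ψ : V → ℝ} (hψ : (Function.support ψ).Finite) :
    G.energy f ψ = ∑' x, G.flow f x * ψ x := by
  set F : V × V → ℝ := fun p => G.b p.1 p.2 * (f p.1 - f p.2) * ψ p.1 with hF
  have hsupp : Function.HasFiniteSupport F := by
    refine (hψ.biUnion fun x _ => (G.locallyFinite x).image fun y => (x, y)).subset ?_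
    rintro ⟨x, y⟩ h
    rw [Function.mem_support] at h
    refine Set.mem_biUnion (x := x) (fun h0 => h (by simp [hF, h0])) ⟨y, ?_, rfl⟩
    exact lt_of_le_of_ne (G.b_nonneg x y) fun h0 => h (by simp [hF, ← h0])
  have hs : Summable F := summable_of_hasFiniteSupport hsupp
  have hs' : Summable fun p : V × V => F p.swap := (Equiv.prodComm V V).summable_iff.2 hs
  have h1 : ∑' p : V × V, F p.swap = ∑' p, F p := (Equiv.prodComm V V).tsum_eq F
  -- Splitting `ψ(x) - ψ(y)` gives two terms exchanged by swapping the edge, with equal sums; this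
  -- absorbs the factor `1/2`.
  have h2 : (fun p : V × V => G.b p.1 p.2 * (f p.1 - f p.2) * (ψ p.1 - ψ p.2)) =
      fun p => F p + F p.swap := by
    funext p
    simp only [hF, Prod.fst_swap, Prod.snd_swap, G.b_symm p.2 p.1]
    ring
  rw [energy, h2, hs.tsum_add hs', h1, hs.tsum_prod]
  have h3 : ∀ x, ∑' y, F (x, y) = G.flow f x * ψ x := fun x => by
    rw [flow, ← tsum_mul_right]
  simp only [h3]
  ring

/-- A positive function `f` with `L f ≥ w f` gives a Hardy inequality with weight `w`. -/
lemma tsum_weight_le_energy {f w : V → ℝ} (hf : ∀ x, 0 < f x)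
    (hw : ∀ x, w x * f x * G.m x ≤ G.flow f x) {φ : V → ℝ} (hφ : (Function.support φ).Finite) :
    ∑' x, w x * φ x ^ 2 * G.m x ≤ G.energy φ φ := by
  -- The supersolution inequality is tested against `φ²/f`, which turns its left side into the Hardy
  -- weight.
  set ψ : V → ℝ := fun x => φ x ^ 2 / f x with hψ
  have hψs : (Function.support ψ).Finite := hφ.subset fun x hx h0 => hx (by simp [hψ, h0])
  have h1 : ∑' x, w x * φ x ^ 2 * G.m x ≤ ∑' x, G.flow f x * ψ x := by
    refine Summable.tsum_le_tsum (fun x => ?_) ?_ ?_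
    · have h := mul_le_mul_of_nonneg_right (hw x) (div_nonneg (sq_nonneg (φ x)) (hf x).le)
      refine le_trans (le_of_eq ?_) h
      have := (hf x).ne'
      field_simp
    · exact summable_of_hasFiniteSupport (hφ.subset fun x hx h0 => hx (by simp [h0]))
    · exact summable_of_hasFiniteSupport (hψs.subset fun x hx h0 => hx (by simp [h0]))
  rw [← G.energy_eq_tsum_flow f hψs] at h1
  refine h1.trans (mul_le_mul_of_nonneg_left ?_ (by norm_num))
  have hfin : ∀ (f : V → ℝ) {ψ : V → ℝ}, (Function.support ψ).Finite →
      Summable fun p : V × V => G.b p.1 p.2 * (f p.1 - f p.2) * (ψ p.1 - ψ p.2) := by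
    intro f ψ hψ
    refine summable_of_hasFiniteSupport
      ((hψ.biUnion fun x _ => (((G.locallyFinite x).image fun y => (x, y)).union
        ((G.locallyFinite x).image fun y => (y, x)))).subset ?_)
    rintro ⟨x, y⟩ h
    rw [Function.mem_support] at h
    have hb : 0 < G.b x y := lt_of_le_of_ne (G.b_nonneg x y) fun h0 => h (by simp [← h0])
    by_cases hx : ψ x = 0
    · refine Set.mem_biUnion (x := y) (fun h0 => h (by simp [h0, hx])) (Or.inr ⟨x, ?_, rfl⟩)
      change 0 < G.b y x
      rwa [G.b_symm]
    · exact Set.mem_biUnion (x := x) hx (Or.inl ⟨y, hb, rfl⟩)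
  refine Summable.tsum_le_tsum (fun p => ?_) (hfin f hψs) (hfin φ hφ)
  rw [mul_assoc, mul_assoc]
  refine mul_le_mul_of_nonneg_left ?_ (G.b_nonneg _ _)
  have ha := hf p.1
  have hb := hf p.2
  -- Picone's identity: on each edge the energy of `φ` exceeds the mixed energy of `f` and `φ²/f` by
  -- a nonnegative term.
  have hkey : (φ p.1 - φ p.2) * (φ p.1 - φ p.2) - (f p.1 - f p.2) * (ψ p.1 - ψ p.2) =
      (φ p.1 * f p.2 - φ p.2 * f p.1) ^ 2 / (f p.1 * f p.2) := by
    simp only [hψ]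
    field_simp
    ring
  have : 0 ≤ (φ p.1 * f p.2 - φ p.2 * f p.1) ^ 2 / (f p.1 * f p.2) := by positivity
  linarith

end

section

variable {V : Type*} (G : WeightedGraph V)

/-! ### Completeness of `ℓ²(V, m)` -/

variable {G}

lemma L2.norm_sq (f : G.L2) : ‖f‖ ^ 2 = ∑' x, f x ^ 2 * G.m x := by
  rw [← real_inner_self_eq_norm_sq, L2.inner_def]
  exact tsum_congr fun x => by ring

variable (G)

/-- Multiplication by `√m` as a map from `ℓ²(V, m)` to the unweighted `ℓ²(V)`. -/
def L2.toLp : G.L2 →ₗ[ℝ] lp (fun _ : V => ℝ) 2 where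
  toFun f := ⟨fun x => f x * √(G.m x), by
    refine (memℓp_gen_iff (by norm_num)).2 (f.summable_sq.congr fun x => ?_)
    rw [ENNReal.toReal_ofNat, Real.rpow_ofNat, Real.norm_eq_abs, sq_abs, mul_pow,
      Real.sq_sqrt (G.m_pos x).le]⟩
  map_add' f g := by
    ext x
    exact add_mul _ _ _
  map_smul' c f := by
    ext x
    exact mul_assoc _ _ _

lemma L2.norm_toLp (f : G.L2) : ‖L2.toLp G f‖ = ‖f‖ := by
  rw [← sq_eq_sq₀ (norm_nonneg _) (norm_nonneg _), L2.norm_sq, ← real_inner_self_eq_norm_sq,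
    lp.inner_eq_tsum]
  refine tsum_congr fun x => ?_
  change (f x * √(G.m x)) * (f x * √(G.m x)) = _
  rw [mul_mul_mul_comm, Real.mul_self_sqrt (G.m_pos x).le, sq]

lemma L2.toLp_surjective : Function.Surjective (L2.toLp G) := by
  intro g
  refine ⟨⟨fun x => g x / √(G.m x), ?_⟩, ?_⟩
  · refine ((memℓp_gen_iff (by norm_num)).1 (lp.memℓp g)).congr fun x => ?_
    rw [ENNReal.toReal_ofNat, Real.rpow_ofNat, Real.norm_eq_abs, sq_abs, div_pow,
      Real.sq_sqrt (G.m_pos x).le, div_mul_cancel₀ _ (G.m_pos x).ne']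
  · ext x
    exact div_mul_cancel₀ _ (Real.sqrt_pos.2 (G.m_pos x)).ne'

instance : CompleteSpace G.L2 :=
  ((AddMonoidHomClass.isometry_of_norm (L2.toLp G)
    (L2.norm_toLp G)).isUniformInducing.completeSpace_congr (L2.toLp_surjective G)).2 inferInstance

/-- A finitely supported function as an element of `ℓ²(V, m)`. -/
def L2.ofFinite (φ : V → ℝ) (hφ : (Function.support φ).Finite) : G.L2 :=
  ⟨φ, summable_of_hasFiniteSupport (hφ.subset fun x hx h0 => hx (by simp [h0]))⟩

variable {G}

/-- Evaluation at `x` is the inner product with the point mass at `x`, divided by `m(x)`. -/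
lemma L2.continuous_apply (x : V) : Continuous fun f : G.L2 => f x := by
  classical
  let δ : G.L2 := L2.ofFinite G (Pi.single x 1)
    ((Set.finite_singleton x).subset Pi.support_single_subset)
  have h : (fun f : G.L2 => f x) = fun f : G.L2 => inner ℝ δ f / G.m x := by
    funext f
    rw [L2.inner_def, tsum_eq_single x, eq_div_iff (G.m_pos x).ne']
    · have h2 : δ x = 1 := Pi.single_eq_same x 1
      rw [h2, one_mul]
    · intro y hy
      have h2 : δ y = 0 := Pi.single_eq_of_ne hy 1
      simp [h2]
  rw [h]
  fun_prop

/-! ### The form domain as a Hilbert space -/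

lemma energy_comm (f g : V → ℝ) : G.energy f g = G.energy g f := by
  unfold energy
  congr 1
  exact tsum_congr fun p => by ring

/-- Fatou's lemma: finite partial sums of the energy pass to the pointwise limit and keep the bound.
-/
lemma energy_le_of_tendsto {F : ℕ → V → ℝ} {f : V → ℝ}
    (hF : ∀ x, Tendsto (fun k => F k x) atTop (𝓝 (f x))) {C : ℝ}
    (hC : ∀ᶠ k in atTop, G.FiniteEnergy (F k) ∧ G.energy (F k) (F k) ≤ C) :
    G.FiniteEnergy f ∧ G.energy f f ≤ C := by
  have key : ∀ s : Finset (V × V), ∑ p ∈ s, G.b p.1 p.2 * (f p.1 - f p.2) ^ 2 ≤ 2 * C := by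
    intro s
    refine le_of_tendsto (x := atTop)
      (f := fun k => ∑ p ∈ s, G.b p.1 p.2 * (F k p.1 - F k p.2) ^ 2) ?_ ?_
    · exact tendsto_finsetSum _ fun p _ => (((hF p.1).sub (hF p.2)).pow 2).const_mul _
    · filter_upwards [hC] with k hk
      have h1 := hk.1.sum_le_tsum s fun p _ => mul_nonneg (G.b_nonneg _ _) (sq_nonneg _)
      have h2 := hk.2
      unfold energy at h2
      simp only [mul_assoc, ← sq] at h2
      linarith
  have h0 : ∀ p : V × V, 0 ≤ G.b p.1 p.2 * (f p.1 - f p.2) ^ 2 :=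
    fun p => mul_nonneg (G.b_nonneg _ _) (sq_nonneg _)
  have hs : G.FiniteEnergy f := summable_of_sum_le h0 key
  refine ⟨hs, ?_⟩
  have h1 := Summable.tsum_le_of_sum_le hs key
  unfold energy
  simp only [mul_assoc, ← sq]
  linarith

variable (G)

/-- The form domain `D(Q)` with the inner product `⟨·,·⟩ + Q(·,·)`. -/
def FormSpace : Type _ := G.formDomain

instance : AddCommGroup G.FormSpace := inferInstanceAs (AddCommGroup G.formDomain)

instance : Module ℝ G.FormSpace := inferInstanceAs (Module ℝ G.formDomain)

/-- The inclusion of the form domain into `ℓ²(V, m)` as a linear map. -/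
def FormSpace.toL2 : G.FormSpace →ₗ[ℝ] G.L2 := G.formDomain.subtype

variable {G}

lemma FormSpace.finiteEnergy (u : G.FormSpace) : G.FiniteEnergy (FormSpace.toL2 G u) := u.2.1

lemma FormSpace.toL2_injective : Function.Injective (FormSpace.toL2 G) := Subtype.coe_injective

/-- An element of the form domain as an element of the form space. -/
def FormSpace.mk (f : G.L2) (hf : f ∈ G.formDomain) : G.FormSpace := ⟨f, hf⟩

@[simp] lemma FormSpace.toL2_mk (f : G.L2) (hf : f ∈ G.formDomain) :
    FormSpace.toL2 G (FormSpace.mk f hf) = f := rfl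

variable (G)

/-- The inner product `⟨·,·⟩ + Q(·,·)` on the form domain. -/
@[reducible] def FormSpace.core : InnerProductSpace.Core ℝ G.FormSpace where
  inner u v := inner ℝ (FormSpace.toL2 G u) (FormSpace.toL2 G v) +
    G.energy (FormSpace.toL2 G u) (FormSpace.toL2 G v)
  conj_inner_symm u v := by
    simp only [conj_trivial]
    rw [real_inner_comm, energy_comm]
  re_inner_nonneg u := add_nonneg real_inner_self_nonneg (energy_self_nonneg _)
  add_left u v w := by
    have h := energy_add_left u.finiteEnergy v.finiteEnergy w.finiteEnergy
    rw [map_add, inner_add_left]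
    refine (congrArg _ h).trans ?_
    ring
  smul_left u v c := by
    have h := energy_smul_left (G := G) c (FormSpace.toL2 G u) (FormSpace.toL2 G v)
    rw [map_smul, real_inner_smul_left, conj_trivial]
    refine (congrArg _ h).trans ?_
    ring
  definite u hu := by
    have h1 : 0 ≤ inner ℝ (FormSpace.toL2 G u) (FormSpace.toL2 G u) := real_inner_self_nonneg
    have h2 := energy_self_nonneg (G := G) (FormSpace.toL2 G u)
    have h3 : inner ℝ (FormSpace.toL2 G u) (FormSpace.toL2 G u) = 0 := by linarith
    exact FormSpace.toL2_injective ((inner_self_eq_zero.1 h3).trans (map_zero _).symm)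

instance : NormedAddCommGroup G.FormSpace := (FormSpace.core G).toNormedAddCommGroup

instance : InnerProductSpace ℝ G.FormSpace := InnerProductSpace.ofCore (FormSpace.core G).toCore

variable {G}

lemma FormSpace.inner_def (u v : G.FormSpace) :
    inner ℝ u v = inner ℝ (FormSpace.toL2 G u) (FormSpace.toL2 G v) +
      G.energy (FormSpace.toL2 G u) (FormSpace.toL2 G v) := rfl

lemma FormSpace.norm_sq (u : G.FormSpace) :
    ‖u‖ ^ 2 = ‖FormSpace.toL2 G u‖ ^ 2 +
      G.energy (FormSpace.toL2 G u) (FormSpace.toL2 G u) := by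
  rw [← real_inner_self_eq_norm_sq, ← real_inner_self_eq_norm_sq, FormSpace.inner_def]

lemma FormSpace.norm_toL2_le (u : G.FormSpace) : ‖FormSpace.toL2 G u‖ ≤ ‖u‖ := by
  have h := u.norm_sq
  have h2 := energy_self_nonneg (G := G) (FormSpace.toL2 G u)
  exact (sq_le_sq₀ (norm_nonneg _) (norm_nonneg _)).1 (by linarith)

end

section

variable {V : Type*} (G : WeightedGraph V)

/-- The inclusion of the form domain into `ℓ²(V, m)`. -/
def FormSpace.incl : G.FormSpace →L[ℝ] G.L2 :=
  (FormSpace.toL2 G).mkContinuous 1 fun u => by simpa using u.norm_toL2_le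

variable {G}

lemma FormSpace.incl_mem (u : G.FormSpace) : FormSpace.incl G u ∈ G.formDomain := u.2

@[simp] lemma FormSpace.incl_mk (f : G.L2) (hf : f ∈ G.formDomain) :
    FormSpace.incl G (FormSpace.mk f hf) = f := rfl

lemma FormSpace.energy_eq (u v : G.FormSpace) :
    G.energy (FormSpace.incl G u) (FormSpace.incl G v) =
      inner ℝ u v - inner ℝ (FormSpace.incl G u) (FormSpace.incl G v) :=
  eq_sub_of_add_eq' (FormSpace.inner_def u v).symm

lemma FormSpace.energy_self_eq (u : G.FormSpace) :
    G.energy (FormSpace.incl G u) (FormSpace.incl G u) =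
      ‖u‖ ^ 2 - ‖FormSpace.incl G u‖ ^ 2 := by
  rw [FormSpace.energy_eq, real_inner_self_eq_norm_sq, real_inner_self_eq_norm_sq]

lemma FormSpace.exists_finite_support_norm_lt (u : G.FormSpace) {ε : ℝ} (hε : 0 < ε) :
    ∃ φ : G.FormSpace, (Function.support (FormSpace.incl G φ)).Finite ∧ ‖u - φ‖ < ε := by
  obtain ⟨φ, hφ, h⟩ := u.2.2 (ε ^ 2) (by positivity)
  refine ⟨FormSpace.mk φ (mem_formDomain_of_finite_support hφ), hφ, ?_⟩
  refine lt_of_pow_lt_pow_left₀ 2 hε.le ?_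
  rw [FormSpace.norm_sq]
  exact h

lemma FormSpace.exists_seq_tendsto (u : G.FormSpace) :
    ∃ φ : ℕ → G.FormSpace, (∀ k, (Function.support (FormSpace.incl G (φ k))).Finite) ∧
      Tendsto φ atTop (𝓝 u) := by
  choose φ hφ h using fun k : ℕ => u.exists_finite_support_norm_lt (ε := 1 / ((k : ℝ) + 1))
    (by positivity)
  refine ⟨φ, hφ, tendsto_iff_norm_sub_tendsto_zero.2 ?_⟩
  refine squeeze_zero (fun _ => norm_nonneg _) (fun k => ?_) tendsto_one_div_add_atTop_nhds_zero_nat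
  rw [norm_sub_rev]
  exact (h k).le

/-- This is closedness of `Q`. A Cauchy sequence has an `ℓ²` limit, and lower semicontinuity applied
to `u k - u n` with `n` fixed shows that its energy distance to the `u n` tends to zero. The limit
lies in `D(Q)` because each `u n` is approximated by finitely supported functions. -/
instance : CompleteSpace G.FormSpace := by
  refine Metric.complete_of_cauchySeq_tendsto fun u hu => ?_
  obtain ⟨f, hf⟩ := cauchySeq_tendsto_of_complete 
    ((FormSpace.incl G).uniformContinuous.comp_cauchySeq hu)
  have hlim : ∀ n x, Tendsto (fun k => FormSpace.incl G (u k) x - FormSpace.incl G (u n) x) atTop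
      (𝓝 (f x - FormSpace.incl G (u n) x)) := fun n x =>
    (((L2.continuous_apply x).tendsto f).comp hf).sub_const _
  have hQ : ∀ ε > 0, ∃ N, ∀ n ≥ N,
      G.FiniteEnergy (fun x => f x - FormSpace.incl G (u n) x) ∧
      ‖f - FormSpace.incl G (u n)‖ ^ 2 + G.energy (fun x => f x - FormSpace.incl G (u n) x)
        (fun x => f x - FormSpace.incl G (u n) x) ≤ 2 * ε ^ 2 := by
    intro ε hε
    obtain ⟨N, hN⟩ := Metric.cauchySeq_iff.1 hu ε hε
    refine ⟨N, fun n hn => ?_⟩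
    have hb : ∀ k ≥ N, ‖u k - u n‖ ^ 2 ≤ ε ^ 2 := fun k hk =>
      pow_le_pow_left₀ (norm_nonneg _) (by simpa [dist_eq_norm] using (hN k hk n hn).le) 2
    have h1 := energy_le_of_tendsto (C := ε ^ 2) (hlim n) <| by
      filter_upwards [eventually_ge_atTop N] with k hk
      refine ⟨(u k - u n).finiteEnergy, ?_⟩
      have h2 := FormSpace.energy_self_eq (u k - u n)
      have h3 := hb k hk
      have h4 := sq_nonneg ‖FormSpace.incl G (u k - u n)‖
      exact h2.le.trans (by linarith)
    refine ⟨h1.1, ?_⟩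
    have h5 : ‖f - FormSpace.incl G (u n)‖ ^ 2 ≤ ε ^ 2 := by
      refine le_of_tendsto (((hf.sub_const (FormSpace.incl G (u n))).norm).pow 2) ?_
      filter_upwards [eventually_ge_atTop N] with k hk
      refine le_trans (pow_le_pow_left₀ (norm_nonneg _) ?_ 2) (hb k hk)
      exact (u k - u n).norm_toL2_le
    linarith [h1.2]
  have hfE : G.FiniteEnergy f := by
    obtain ⟨N, hN⟩ := hQ 1 one_pos
    have h := (hN N le_rfl).1.add (u N).finiteEnergy
    convert h using 2 with x
    exact (sub_add_cancel _ _).symm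
  have hfD : f ∈ G.formDomain := by
    refine ⟨hfE, fun ε hε => ?_⟩
    obtain ⟨N, hN⟩ := hQ (√(ε / 8)) (by positivity)
    obtain ⟨φ, hφ, h⟩ := (u N).2.2 (ε / 4) (by positivity)
    refine ⟨φ, hφ, ?_⟩
    have h1 := (hN N le_rfl).2
    rw [Real.sq_sqrt (by positivity)] at h1
    have e1 := energy_add_self_le (hN N le_rfl).1
      ((u N).finiteEnergy.sub (finiteEnergy_of_finite_support hφ))
    have e2 : ‖f - φ‖ ^ 2 ≤ 2 * ‖f - FormSpace.incl G (u N)‖ ^ 2 +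
        2 * ‖FormSpace.incl G (u N) - φ‖ ^ 2 := by
      have := norm_sub_le_norm_sub_add_norm_sub f (FormSpace.incl G (u N)) φ
      nlinarith [norm_nonneg (f - φ),
        sq_nonneg (‖f - FormSpace.incl G (u N)‖ - ‖FormSpace.incl G (u N) - φ‖)]
    have e3 : (fun x => f x - FormSpace.incl G (u N) x + (FormSpace.toL2 G (u N) x - φ x)) =
        fun x => f x - φ x := by
      funext x
      exact sub_add_sub_cancel _ _ _
    rw [e3] at e1
    change ‖FormSpace.incl G (u N) - φ‖ ^ 2 + _ < _ at h
    have h' : G.energy (fun x => FormSpace.toL2 G (u N) x - φ x)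
        (fun x => FormSpace.toL2 G (u N) x - φ x) < ε / 4 - ‖FormSpace.incl G (u N) - φ‖ ^ 2 :=
      lt_sub_iff_add_lt'.2 h
    linarith
  refine ⟨FormSpace.mk f hfD, tendsto_iff_norm_sub_tendsto_zero.2 ?_⟩
  refine Metric.tendsto_atTop.2 fun ε hε => ?_
  obtain ⟨N, hN⟩ := hQ (ε / 2) (by positivity)
  refine ⟨N, fun n hn => ?_⟩
  rw [Real.dist_eq, sub_zero, abs_of_nonneg (norm_nonneg _), norm_sub_rev]
  refine lt_of_pow_lt_pow_left₀ 2 hε.le ?_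
  have h1 : ‖FormSpace.mk f hfD - u n‖ ^ 2 ≤ 2 * (ε / 2) ^ 2 := by
    rw [FormSpace.norm_sq]
    exact (hN n hn).2
  nlinarith

/-- A Hardy inequality for finitely supported functions extends to the form domain. -/
lemma FormSpace.tsum_weight_le_energy {w : V → ℝ} (hw : ∀ x, 0 ≤ w x)
    (h : ∀ φ : V → ℝ, (Function.support φ).Finite →
      ∑' x, w x * φ x ^ 2 * G.m x ≤ G.energy φ φ) (u : G.FormSpace) :
    Summable (fun x => w x * FormSpace.incl G u x ^ 2 * G.m x) ∧
      ∑' x, w x * FormSpace.incl G u x ^ 2 * G.m x ≤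
        G.energy (FormSpace.incl G u) (FormSpace.incl G u) := by
  obtain ⟨φ, hφ, hlim⟩ := u.exists_seq_tendsto
  have hlim2 : Tendsto (fun k => FormSpace.incl G (φ k)) atTop (𝓝 (FormSpace.incl G u)) :=
    ((FormSpace.incl G).continuous.tendsto u).comp hlim
  have hE : Tendsto (fun k => G.energy (FormSpace.incl G (φ k)) (FormSpace.incl G (φ k))) atTop
      (𝓝 (G.energy (FormSpace.incl G u) (FormSpace.incl G u))) := by
    simp only [FormSpace.energy_self_eq]
    exact (hlim.norm.pow 2).sub (hlim2.norm.pow 2)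
  have h0 : ∀ (f : V → ℝ) x, 0 ≤ w x * f x ^ 2 * G.m x := fun f x =>
    mul_nonneg (mul_nonneg (hw x) (sq_nonneg _)) (G.m_pos x).le
  -- The weight may be unbounded, so only finite partial sums of the left side are passed to the
  -- limit; the energy converges because convergence is in the form norm.
  have key : ∀ s : Finset V, ∑ x ∈ s, w x * FormSpace.incl G u x ^ 2 * G.m x ≤
      G.energy (FormSpace.incl G u) (FormSpace.incl G u) := by
    intro s
    refine le_of_tendsto_of_tendsto' (tendsto_finsetSum s fun x _ =>
      (((((L2.continuous_apply x).tendsto _).comp hlim2).pow 2).const_mul (w x)).mul_const _)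
      hE fun k => ?_
    refine le_trans ?_ (h _ (hφ k))
    refine Summable.sum_le_tsum s (fun x _ => h0 _ x) ?_
    exact summable_of_hasFiniteSupport ((hφ k).subset fun x hx h0 => hx (by simp [h0]))
  have hs := summable_of_sum_le (h0 _) key
  exact ⟨hs, Summable.tsum_le_of_sum_le hs key⟩

/-! ### Lower bounds of the form. -/

variable (G)

/-- The form `Q` is bounded below by `c`. -/
def FormBoundedBelow (c : ℝ) : Prop :=
  ∀ φ : V → ℝ, (Function.support φ).Finite → ∑' x, c * φ x ^ 2 * G.m x ≤ G.energy φ φ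

variable {G}

lemma formBoundedBelow_zero : G.FormBoundedBelow 0 := fun φ _ => by
  simpa using energy_self_nonneg φ

lemma FormBoundedBelow.le_energy {c : ℝ} (hc : 0 ≤ c) (h : G.FormBoundedBelow c)
    (u : G.FormSpace) :
    c * ‖FormSpace.incl G u‖ ^ 2 ≤ G.energy (FormSpace.incl G u) (FormSpace.incl G u) := by
  have h1 := (u.tsum_weight_le_energy (w := fun _ => c) (fun _ => hc) h).2
  rw [L2.norm_sq, ← tsum_mul_left]
  simpa only [mul_assoc] using h1

lemma formBoundedBelow_of_le_energy {c : ℝ} (h : ∀ u : G.FormSpace,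
    c * ‖FormSpace.incl G u‖ ^ 2 ≤ G.energy (FormSpace.incl G u) (FormSpace.incl G u)) :
    G.FormBoundedBelow c := by
  intro φ hφ
  have h1 := h (FormSpace.mk (L2.ofFinite G φ hφ) (mem_formDomain_of_finite_support hφ))
  rw [L2.norm_sq, ← tsum_mul_left] at h1
  simp only [← mul_assoc] at h1
  exact h1

/-! ### The operator and its resolvent -/

lemma laplacian_mem_graph (f : G.laplacian.domain) :
    ((f : G.L2), G.laplacian f) ∈ G.laplacianGraph := by
  rw [← laplacian_graph]
  exact LinearPMap.mem_graph _ f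

lemma exists_laplacian_eq {f g : G.L2} (h : (f, g) ∈ G.laplacianGraph) :
    ∃ f' : G.laplacian.domain, f = f' ∧ G.laplacian f' = g := by
  rw [← laplacian_graph, LinearPMap.mem_graph_iff] at h
  obtain ⟨y, h1, h2⟩ := h
  exact ⟨y, h1.symm, h2⟩

lemma mem_laplacianGraph_incl {u : G.FormSpace} {g : G.L2}
    (h : ∀ v : G.FormSpace, G.energy (FormSpace.incl G u) (FormSpace.incl G v) =
      inner ℝ g (FormSpace.incl G v)) : (FormSpace.incl G u, g) ∈ G.laplacianGraph :=
  ⟨u.incl_mem, fun f hf => h (FormSpace.mk f hf)⟩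

/-- Lax–Milgram for `Q - μ⟨·,·⟩` on the form space: with `T` the operator of this form and `J` the
inclusion into `ℓ²`, the resolvent is `J T⁻¹ J*`. -/
lemma mem_resolventSet_of_lt {c μ : ℝ} (hc : 0 ≤ c) (h : G.FormBoundedBelow c) (hμ : μ < c) :
    μ ∈ G.laplacian.resolventSet := by
  let J := FormSpace.incl G
  let B : G.FormSpace →L[ℝ] G.FormSpace →L[ℝ] ℝ :=
    innerSL ℝ - (1 + μ) • (innerSL ℝ : G.L2 →L[ℝ] G.L2 →L[ℝ] ℝ).bilinearComp J J
  have hB : ∀ u v, B u v = G.energy (J u) (J v) - μ * inner ℝ (J u) (J v) := by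
    intro u v
    change inner ℝ u v - (1 + μ) * inner ℝ (J u) (J v) = _
    rw [FormSpace.energy_eq]
    ring
  have hcoer : IsCoercive B := by
    -- Coercivity with constant `k` means `(1-k) Q(u,u) ≥ (μ+k)‖u‖²`. For `k ≤ 1` this follows from
    -- `Q ≥ c` once `k(1+c) ≤ c-μ`.
    refine ⟨min 1 ((c - μ) / (1 + c)), lt_min one_pos (by apply div_pos <;> linarith), fun u => ?_⟩
    set k := min 1 ((c - μ) / (1 + c))
    have hk1 : k ≤ 1 := min_le_left _ _
    have hk2 : k * (1 + c) ≤ c - μ := (le_div_iff₀ (by linarith)).1 (min_le_right _ _)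
    have h1 := h.le_energy hc u
    have h2 := FormSpace.energy_self_eq u
    rw [hB, real_inner_self_eq_norm_sq]
    have h3 := mul_le_mul_of_nonneg_left h1 (sub_nonneg.2 hk1)
    have h4 := mul_le_mul_of_nonneg_right hk2 (sq_nonneg ‖FormSpace.incl G u‖)
    change _ ≤ G.energy (FormSpace.incl G u) (FormSpace.incl G u) -
      μ * ‖FormSpace.incl G u‖ ^ 2
    have h5 : k * ‖u‖ * ‖u‖ = k * (G.energy (FormSpace.incl G u) (FormSpace.incl G u)
        + ‖FormSpace.incl G u‖ ^ 2) := by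
      rw [h2]
      ring
    rw [h5]
    linarith
  let T := hcoer.continuousLinearEquivOfBilin
  let A := ContinuousLinearMap.adjoint J
  have hT : ∀ u v, inner ℝ (T u) v = G.energy (J u) (J v) - μ * inner ℝ (J u) (J v) :=
    fun u v => (hcoer.continuousLinearEquivOfBilin_apply u v).trans (hB u v)
  have hA : ∀ g v, inner ℝ (A g) v = inner ℝ g (J v) :=
    fun g v => ContinuousLinearMap.adjoint_inner_left J v g
  refine ⟨J ∘L (T.symm : G.FormSpace →L[ℝ] G.FormSpace) ∘L A, fun f => ?_, fun g => ?_⟩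
  · have hf := laplacian_mem_graph f
    let u : G.FormSpace := FormSpace.mk f hf.1
    have h1 : A (G.laplacian f - μ • (f : G.L2)) = T u := by
      refine ext_inner_right ℝ fun v => ?_
      rw [hA, hT, inner_sub_left, real_inner_smul_left]
      congr 1
      exact (hf.2 _ v.incl_mem).symm
    change J (T.symm (A _)) = _
    rw [h1, T.symm_apply_apply]
    rfl
  · set u := T.symm (A g) with hu
    have h1 : (J u, g + μ • J u) ∈ G.laplacianGraph := mem_laplacianGraph_incl fun v => by
      have h2 := hT u v
      rw [hu, T.apply_symm_apply, hA, ← hu] at h2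
      rw [inner_add_left, real_inner_smul_left]
      exact (sub_eq_iff_eq_add.1 h2.symm)
    obtain ⟨f, h2, h3⟩ := exists_laplacian_eq h1
    refine ⟨f, h2, ?_⟩
    rw [h3, ← h2]
    exact add_sub_cancel_right _ _

lemma le_bottomOfSpectrum {c : ℝ} (h : G.FormBoundedBelow c) :
    (c : EReal) ≤ G.laplacian.bottomOfSpectrum := by
  refine le_iInf₂ fun μ hμ => EReal.coe_le_coe_iff.2 (not_lt.1 fun hlt => hμ ?_)
  rcases le_total 0 c with hc | hc
  · exact mem_resolventSet_of_lt hc h hlt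
  · exact mem_resolventSet_of_lt le_rfl formBoundedBelow_zero (hlt.trans_le hc)

/-- A bounded resolvent at `c` leaves room below the form. With `q = Q - c⟨·,·⟩ ≥ 0`, `u = Rv` and
`C = ‖R‖ + 1`, one has `q(u,v) = ‖v‖²` and `q(u,u) = ⟨v,Rv⟩ ≤ (C-1)‖v‖²`. Expanding `q(u - Cv, u -
Cv) ≥ 0` then gives `q(v,v) ≥ ‖v‖²/C`. No spectral theorem is involved. -/
lemma exists_formBoundedBelow_lt {c : ℝ} (hc : 0 ≤ c) (h : G.FormBoundedBelow c)
    (hres : c ∈ G.laplacian.resolventSet) : ∃ c' > c, G.FormBoundedBelow c' := by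
  obtain ⟨R, -, hR⟩ := hres
  have hC : 0 < ‖R‖ + 1 := by positivity
  refine ⟨c + 1 / (‖R‖ + 1), by simpa using hC, formBoundedBelow_of_le_energy fun v => ?_⟩
  set g := FormSpace.incl G v with hg
  obtain ⟨f, h1, h2⟩ := hR g
  have hf := laplacian_mem_graph f
  let u : G.FormSpace := FormSpace.mk f hf.1
  have hu : FormSpace.incl G u = f := rfl
  have hq : ∀ w : G.FormSpace, G.energy f (FormSpace.incl G w) =
      inner ℝ g (FormSpace.incl G w) + c * inner ℝ (f : G.L2) (FormSpace.incl G w) := fun w => by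
    rw [hf.2 _ w.incl_mem, ← h2, inner_sub_left, real_inner_smul_left]
    ring
  have h3 := h.le_energy hc (u - (‖R‖ + 1) • v)
  rw [FormSpace.energy_eq] at h3
  have h4 := hq u
  have h5 := hq v
  have h6 := FormSpace.energy_eq v v
  rw [← hu, FormSpace.energy_eq] at h4 h5
  rw [← hg] at h5 h6
  have h7 : inner ℝ g (FormSpace.incl G u) ≤ ‖R‖ * ‖g‖ ^ 2 := by
    refine (real_inner_le_norm _ _).trans ?_
    rw [hu, ← h1]
    have := R.le_opNorm g
    nlinarith [norm_nonneg g]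
  have h8 := real_inner_comm v u
  have h9 := real_inner_comm g (FormSpace.incl G u)
  rw [← real_inner_self_eq_norm_sq] at h3 h7 ⊢
  simp only [map_sub, map_smul, inner_sub_left, inner_sub_right, real_inner_smul_left,
    real_inner_smul_right, ← hg] at h3
  rw [h6]
  set C := ‖R‖ + 1 with hCdef
  have hR' : ‖R‖ = C - 1 := by rw [hCdef]; ring
  rw [hR'] at h7
  have hn : 0 ≤ inner ℝ g g := real_inner_self_nonneg
  have key : 0 ≤ C * (C * (inner ℝ v v - inner ℝ g g - c * inner ℝ g g) - inner ℝ g g) := by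
    rw [h8, h9] at h3 h5
    have h10 := congrArg (C * ·) h5
    linarith
  have key2 := nonneg_of_mul_nonneg_right key hC
  have : 1 / C * inner ℝ g g ≤ inner ℝ v v - inner ℝ g g - c * inner ℝ g g := by
    rw [one_div_mul_eq_div, div_le_iff₀ hC]
    linarith
  linarith

/-- The supremum of all lower bounds is itself a lower bound, and it lies in the spectrum since
otherwise it could be improved. A point mass shows that the supremum is finite. -/
lemma formBoundedBelow_of_le_bottomOfSpectrum [Nonempty V] {c : ℝ}
    (h : (c : EReal) ≤ G.laplacian.bottomOfSpectrum) : G.FormBoundedBelow c := by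
  classical
  obtain ⟨x⟩ := ‹Nonempty V›
  have hδ : (Function.support (Pi.single (M := fun _ => ℝ) x (1 : ℝ))).Finite :=
    (Set.finite_singleton x).subset Pi.support_single_subset
  set S := {c : ℝ | G.FormBoundedBelow c} with hS
  have hS0 : (0 : ℝ) ∈ S := formBoundedBelow_zero
  have hSb : BddAbove S := by
    refine ⟨G.energy (Pi.single x 1) (Pi.single x 1) / G.m x, fun c hc => ?_⟩
    have h1 := hc _ hδ
    rw [tsum_eq_single x (fun y hy => by simp [hy])] at h1
    rw [le_div_iff₀ (G.m_pos x)]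
    simpa using h1
  have hmono : ∀ {c c' : ℝ}, c ≤ c' → G.FormBoundedBelow c' → G.FormBoundedBelow c := by
    intro c c' hcc h φ hφ
    refine le_trans (Summable.tsum_le_tsum (fun y => ?_) ?_ ?_) (h φ hφ)
    · exact mul_le_mul_of_nonneg_right (mul_le_mul_of_nonneg_right hcc (sq_nonneg _)) (G.m_pos y).le
    · exact summable_of_hasFiniteSupport (hφ.subset fun x hx h0 => hx (by simp [h0]))
    · exact summable_of_hasFiniteSupport (hφ.subset fun x hx h0 => hx (by simp [h0]))
  have hsup : G.FormBoundedBelow (sSup S) := by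
    refine formBoundedBelow_of_le_energy fun u => ?_
    rcases eq_or_lt_of_le (sq_nonneg ‖FormSpace.incl G u‖) with h0 | h0
    · rw [← h0, mul_zero]
      exact energy_self_nonneg _
    rw [← le_div_iff₀ h0]
    refine csSup_le ⟨0, hS0⟩ fun c hc => ?_
    rw [le_div_iff₀ h0]
    rcases le_total 0 c with hc0 | hc0
    · exact FormBoundedBelow.le_energy hc0 hc u
    · exact (mul_nonpos_of_nonpos_of_nonneg hc0 h0.le).trans (energy_self_nonneg _)
  have hspec : sSup S ∈ G.laplacian.spectrum := by
    intro hres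
    obtain ⟨c', hc', h'⟩ := exists_formBoundedBelow_lt (le_csSup hSb hS0) hsup hres
    exact absurd (le_csSup hSb h') (not_le.2 hc')
  exact hmono (EReal.coe_le_coe_iff.1 (h.trans (iInf₂_le _ hspec))) hsup

end

section

variable {V : Type*} {G : WeightedGraph V}

/-! ### Radial solutions -/

/-- The solution `g` of `κ₊(r) (g(r) - g(r+1)) + κ₋(r) (g(r) - g(r-1)) = c g(r)` with `g(0) = 1`. -/
def radialSolution (kp km : ℕ → ℝ) (c : ℝ) : ℕ → ℝ
  | 0 => 1
  | 1 => 1 - c / kp 0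
  | n + 2 => radialSolution kp km c (n + 1) - (c * radialSolution kp km c (n + 1) -
      km (n + 1) * (radialSolution kp km c (n + 1) - radialSolution kp km c n)) / kp (n + 1)

lemma radialSolution_zero (kp km : ℕ → ℝ) (c : ℝ) : radialSolution kp km c 0 = 1 := by
  rw [radialSolution]

lemma radialSolution_eq {kp km : ℕ → ℝ} {c : ℝ} (hkp : ∀ r, 0 < kp r) (r : ℕ) :
    kp r * (radialSolution kp km c r - radialSolution kp km c (r + 1)) +
      km r * (radialSolution kp km c r - radialSolution kp km c (r - 1)) =
      c * radialSolution kp km c r := by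
  cases r with
  | zero =>
    have := (hkp 0).ne'
    simp only [radialSolution, Nat.zero_sub]
    field_simp
    ring
  | succ n =>
    have := (hkp (n + 1)).ne'
    rw [radialSolution, Nat.add_sub_cancel]
    field_simp
    ring

/-- The equation reads `κ₊(k)(g(k) - g(k+1)) = c g(k) + κ₋(k)(g(k-1) - g(k))`, and inductively both
terms on the right are nonnegative. Positivity is assumed only up to `r`, so that this applies
before the first zero of `g`. -/
lemma radialSolution_succ_le {kp km : ℕ → ℝ} {c : ℝ} (hkp : ∀ r, 0 < kp r) (hkm : ∀ r, 0 ≤ km r)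
    (hc : 0 ≤ c) {r : ℕ} (hpos : ∀ k ≤ r, 0 < radialSolution kp km c k) :
    ∀ k ≤ r, radialSolution kp km c (k + 1) ≤ radialSolution kp km c k := by
  intro k
  induction k with
  | zero =>
    intro _
    have h := radialSolution_eq (km := km) (c := c) hkp 0
    rw [radialSolution_zero] at h
    have := nonneg_of_mul_nonneg_right (a := kp 0) (b := 1 - radialSolution kp km c 1)
      (by simp only [sub_self] at h; linarith) (hkp 0)
    rw [radialSolution_zero]
    linarith
  | succ k ih =>
    intro hk
    have h := radialSolution_eq (km := km) (c := c) hkp (k + 1)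
    rw [Nat.add_sub_cancel] at h
    have h1 := ih (by omega)
    have h2 := mul_nonneg hc (hpos (k + 1) hk).le
    have h3 := mul_nonneg (hkm (k + 1)) (sub_nonneg.2 h1)
    have := nonneg_of_mul_nonneg_right (a := kp (k + 1))
      (b := radialSolution kp km c (k + 1) - radialSolution kp km c (k + 1 + 1))
      (by linarith) (hkp _)
    linarith

/-! ### Comparison -/

/-- As `g` decreases, `g(r) - g(r+1) ≥ 0` and `g(r) - g(r-1) ≤ 0`, so a larger `κ₊` and a smaller
`κ₋` both preserve the supersolution inequality. -/
lemma weight_le_energy_of_radial {x₀ : V} {kp km w g : ℕ → ℝ} (hg : ∀ r, 0 < g r)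
    (hg' : Antitone g)
    (hw : ∀ r, w r * g r ≤ kp r * (g r - g (r + 1)) + km r * (g r - g (r - 1)))
    (hp : ∀ x, kp (G.dist x x₀) ≤ G.outerCurvature x₀ x)
    (hm : ∀ x, G.innerCurvature x₀ x ≤ km (G.dist x x₀))
    {φ : V → ℝ} (hφ : (Function.support φ).Finite) :
    ∑' x, w (G.dist x x₀) * φ x ^ 2 * G.m x ≤ G.energy φ φ := by
  refine G.tsum_weight_le_energy (f := fun x => g (G.dist x x₀))
    (w := fun x => w (G.dist x x₀)) (fun _ => hg _) (fun x => ?_) hφ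
  rw [flow_radial, mul_comm]
  refine mul_le_mul_of_nonneg_left ((hw _).trans (add_le_add ?_ ?_)) (G.m_pos x).le
  · exact mul_le_mul_of_nonneg_right (hp x) (sub_nonneg.2 (hg' (Nat.le_succ _)))
  · exact mul_le_mul_of_nonpos_right (hm x) (sub_nonpos.2 (hg' (Nat.sub_le _ _)))

/-- If positivity first failed at radius `n+1`, then `g` cut off beyond `n` would be a test function
of energy at most `c‖φ‖²`, contradicting the lower bound `c' > c`. -/
lemma radialSolution_pos_of_formBoundedBelow {x₀ : V} {kp km : ℕ → ℝ} (hkp : ∀ r, 0 < kp r)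
    (hkm : ∀ r, 0 ≤ km r) (hp : ∀ x, G.outerCurvature x₀ x ≤ kp (G.dist x x₀))
    (hm : ∀ x, km (G.dist x x₀) ≤ G.innerCurvature x₀ x) {c c' : ℝ} (hc : 0 ≤ c) (hcc : c < c')
    (h : G.FormBoundedBelow c') (r : ℕ) : 0 < radialSolution kp km c r := by
  classical
  by_contra hr
  have hex : ∃ r, ¬ 0 < radialSolution kp km c r := ⟨r, hr⟩
  obtain ⟨n, hn⟩ : ∃ n, Nat.find hex = n + 1 := Nat.exists_eq_succ_of_ne_zero fun h0 => by
    have := Nat.find_spec hex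
    rw [h0, radialSolution_zero] at this
    exact this one_pos
  have hle : radialSolution kp km c (n + 1) ≤ 0 := by
    rw [← hn]
    exact not_lt.1 (Nat.find_spec hex)
  have hpos : ∀ k ≤ n, 0 < radialSolution kp km c k := fun k hk =>
    not_not.1 (Nat.find_min hex (by omega))
  have hanti := radialSolution_succ_le hkp hkm hc hpos
  set g := radialSolution kp km c with hgdef
  set t : ℕ → ℝ := fun k => if k ≤ n then g k else 0 with ht
  set φ : V → ℝ := fun x => t (G.dist x x₀) with hφdef
  have ht1 : ∀ k ≤ n, t k = g k := fun k hk => if_pos hk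
  -- Cutting off replaces `g(n+1) ≤ 0` by the larger value `0`, which can only decrease the flow on
  -- the sphere of radius `n`.
  have ht2 : ∀ k ≤ n, g (k + 1) ≤ t (k + 1) := by
    intro k hk
    rcases hk.eq_or_lt with rfl | hk
    · simpa [ht] using hle
    · exact (ht1 _ hk).ge
  have hφ : (Function.support φ).Finite := by
    refine (G.ball_finite x₀ n).subset fun x hx => ?_
    by_contra hxn
    exact hx (if_neg hxn)
  have hfin : ∀ a : ℝ, Summable fun x => a * φ x ^ 2 * G.m x := fun a =>
    summable_of_hasFiniteSupport (hφ.subset fun x hx h0 => hx (by simp [h0]))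
  have h1 : G.energy φ φ ≤ ∑' x, c * φ x ^ 2 * G.m x := by
    rw [G.energy_eq_tsum_flow φ hφ]
    refine Summable.tsum_le_tsum (fun x => ?_)
      (summable_of_hasFiniteSupport (hφ.subset fun x hx h0 => hx (by simp [h0]))) (hfin c)
    by_cases hx : G.dist x x₀ ≤ n
    · have h2 : φ x = g (G.dist x x₀) := ht1 _ hx
      have h3 : G.flow φ x ≤ G.m x * (c * φ x) := by
        rw [h2, hgdef, ← radialSolution_eq (km := km) hkp, ← hgdef, hφdef, flow_radial, ht1 _ hx,
          ht1 (G.dist x x₀ - 1) (by omega)]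
        refine mul_le_mul_of_nonneg_left (add_le_add ?_ ?_) (G.m_pos x).le
        · refine (mul_le_mul_of_nonneg_left (sub_le_sub_left (ht2 _ hx) _)
            (G.outerCurvature_nonneg x₀ x)).trans ?_
          exact mul_le_mul_of_nonneg_right (hp x) (sub_nonneg.2 (hanti _ hx))
        · refine mul_le_mul_of_nonpos_right (hm x) (sub_nonpos.2 ?_)
          rcases Nat.eq_zero_or_pos (G.dist x x₀) with h0 | h0
          · rw [h0]
          · have := hanti (G.dist x x₀ - 1) (by omega)
            rwa [Nat.sub_add_cancel h0] at this
      have h4 : 0 ≤ φ x := by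
        rw [h2]
        exact (hpos _ hx).le
      calc G.flow φ x * φ x ≤ G.m x * (c * φ x) * φ x := mul_le_mul_of_nonneg_right h3 h4
        _ = c * φ x ^ 2 * G.m x := by ring
    · have h2 : φ x = 0 := if_neg hx
      simp [h2]
  have h5 := (h φ hφ).trans h1
  have h6 : ∑' x, c * φ x ^ 2 * G.m x < ∑' x, c' * φ x ^ 2 * G.m x := by
    refine Summable.tsum_lt_tsum (i := x₀) (fun x => ?_) ?_ (hfin c) (hfin c')
    · exact mul_le_mul_of_nonneg_right (mul_le_mul_of_nonneg_right hcc.le (sq_nonneg _))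
        (G.m_pos x).le
    · have h7 : φ x₀ = 1 := by
        rw [hφdef]
        simp only [dist_root]
        rw [ht1 0 (Nat.zero_le _), hgdef, radialSolution_zero]
      rw [h7]
      simpa using mul_lt_mul_of_pos_right hcc (G.m_pos x₀)
  linarith

/-- The profile `kp`, `km` separates the two graphs, so the symmetric graph can play either role and
both comparisons follow. For `c < c'` below the bottom for `G`, the radial solution is positive by
`G` and a supersolution on `G'`. -/
lemma bottomOfSpectrum_le_of_curvature {W : Type*} {G' : WeightedGraph W} {x₀ : V} {y₀ : W}
    {kp km : ℕ → ℝ} (hkp : ∀ r, 0 < kp r) (hkm : ∀ r, 0 ≤ km r)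
    (hp : ∀ x, G.outerCurvature x₀ x ≤ kp (G.dist x x₀))
    (hm : ∀ x, km (G.dist x x₀) ≤ G.innerCurvature x₀ x)
    (hp' : ∀ y, kp (G'.dist y y₀) ≤ G'.outerCurvature y₀ y)
    (hm' : ∀ y, G'.innerCurvature y₀ y ≤ km (G'.dist y y₀)) :
    G.laplacian.bottomOfSpectrum ≤ G'.laplacian.bottomOfSpectrum := by
  have : Nonempty V := ⟨x₀⟩
  refine le_of_forall_lt_imp_le_of_dense fun e he => ?_
  obtain ⟨c, hec, hc⟩ := EReal.lt_iff_exists_real_btwn.1 he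
  obtain ⟨c', hcc, hc'⟩ := EReal.lt_iff_exists_real_btwn.1 hc
  refine hec.le.trans ?_
  rcases le_total c 0 with h0 | h0
  · exact (EReal.coe_le_coe_iff.2 h0).trans (le_bottomOfSpectrum formBoundedBelow_zero)
  have hpos := radialSolution_pos_of_formBoundedBelow hkp hkm hp hm h0 (EReal.coe_lt_coe_iff.1 hcc)
    (formBoundedBelow_of_le_bottomOfSpectrum hc'.le)
  refine le_bottomOfSpectrum fun φ hφ => ?_
  exact weight_le_energy_of_radial (w := fun _ => c) hpos
    (antitone_nat_of_succ_le fun r => radialSolution_succ_le hkp hkm h0 (fun k _ => hpos k) r le_rfl)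
    (fun r => (radialSolution_eq hkp r).ge) hp' hm' hφ

/-! ### Weakly spherically symmetric graphs -/

lemma tsum_coe_of_finite {α : Type*} {S : Set α} (hS : S.Finite) (f : α → ℝ) :
    ∑' x : S, f x = ∑ x ∈ hS.toFinset, f x := by
  rw [← Finset.tsum_subtype', hS.coe_toFinset]

/-- Curvatures that are functions of the distance to the root `o`. -/
structure HasRadialCurvature (G : WeightedGraph V) (o : V) (kp km : ℕ → ℝ) : Prop where
  outer : ∀ x, G.outerCurvature o x = kp (G.dist x o)
  inner : ∀ x, G.innerCurvature o x = km (G.dist x o)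

namespace HasRadialCurvature

variable {o : V} {kp km : ℕ → ℝ}

lemma outer_pos [Infinite V] (h : G.HasRadialCurvature o kp km) (r : ℕ) : 0 < kp r := by
  obtain ⟨y, hy⟩ := G.sphere_nonempty o (r + 1)
  obtain ⟨x, hx, hxr⟩ := G.exists_neighbor_closer hy
  have h1 := G.outerCurvature_pos_of_edge (x₀ := o) (x := x) (y := y) (by rwa [G.b_symm])
    (by rw [hxr]; exact hy)
  rwa [h.outer, hxr] at h1

lemma inner_nonneg [Infinite V] (h : G.HasRadialCurvature o kp km) (r : ℕ) : 0 ≤ km r := by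
  obtain ⟨x, hx⟩ := G.sphere_nonempty o r
  have h1 := G.innerCurvature_nonneg o x
  rwa [h.inner, show G.dist x o = r from hx] at h1

lemma ballBoundary_eq (h : G.HasRadialCurvature o kp km) (r : ℕ) :
    G.ballBoundary o r = kp r * ∑ x ∈ (G.sphere_finite o r).toFinset, G.m x := by
  rw [ballBoundary, tsum_coe_of_finite (G.sphere_finite o r) fun x => G.outerCurvature o x * G.m x,
    Finset.mul_sum]
  refine Finset.sum_congr rfl fun x hx => ?_
  rw [h.outer, show G.dist x o = r from (G.sphere_finite o r).mem_toFinset.1 hx]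

/-- The edge weight between consecutive spheres is counted from its outer side, using the symmetry
of `b`. -/
lemma ballBoundary_eq' (h : G.HasRadialCurvature o kp km) (r : ℕ) :
    G.ballBoundary o r = km (r + 1) * ∑ x ∈ (G.sphere_finite o (r + 1)).toFinset, G.m x := by
  have hout : ∀ x ∈ (G.sphere_finite o r).toFinset, G.outerCurvature o x * G.m x =
      ∑ y ∈ (G.sphere_finite o (r + 1)).toFinset, G.b x y := by
    intro x hx
    have hxr : G.dist x o = r := (G.sphere_finite o r).mem_toFinset.1 hx
    rw [mul_comm, mul_outerCurvature, tsum_eq_sum (s := (G.sphere_finite o (r + 1)).toFinset)]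
    · refine Finset.sum_congr rfl fun y hy => ?_
      have hyr : G.dist y o = r + 1 := (G.sphere_finite o (r + 1)).mem_toFinset.1 hy
      simp [hxr, hyr]
    · intro y hy
      have hyr : G.dist y o ≠ r + 1 := fun h0 =>
        hy ((G.sphere_finite o (r + 1)).mem_toFinset.2 h0)
      simp [hxr, hyr]
  have hin : ∀ y ∈ (G.sphere_finite o (r + 1)).toFinset, km (r + 1) * G.m y =
      ∑ x ∈ (G.sphere_finite o r).toFinset, G.b x y := by
    intro y hy
    have hyr : G.dist y o = r + 1 := (G.sphere_finite o (r + 1)).mem_toFinset.1 hy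
    rw [mul_comm, ← hyr, ← h.inner, mul_innerCurvature,
      tsum_eq_sum (s := (G.sphere_finite o r).toFinset)]
    · refine Finset.sum_congr rfl fun x hx => ?_
      have hxr : G.dist x o = r := (G.sphere_finite o r).mem_toFinset.1 hx
      simp [hxr, hyr, G.b_symm x y]
    · intro x hx
      have hxr : G.dist x o ≠ r := fun h0 => hx ((G.sphere_finite o r).mem_toFinset.2 h0)
      simp [hxr, hyr]
  rw [ballBoundary, tsum_coe_of_finite (G.sphere_finite o r) fun x => G.outerCurvature o x * G.m x,
    Finset.mul_sum, Finset.sum_congr rfl hout, Finset.sum_congr rfl hin, Finset.sum_comm]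

end HasRadialCurvature

lemma sum_sphere_pos [Infinite V] (o : V) (r : ℕ) :
    0 < ∑ x ∈ (G.sphere_finite o r).toFinset, G.m x :=
  Finset.sum_pos (fun x _ => G.m_pos x)
    ((G.sphere_finite o r).toFinset_nonempty.2 (G.sphere_nonempty o r))

lemma ballVolume_zero (o : V) :
    G.ballVolume o 0 = ∑ x ∈ (G.sphere_finite o 0).toFinset, G.m x := by
  rw [ballVolume, tsum_coe_of_finite (G.ball_finite o 0)]
  refine Finset.sum_congr ?_ fun _ _ => rfl
  ext x
  simp [ball, sphere]

lemma ballVolume_succ (o : V) (r : ℕ) :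
    G.ballVolume o (r + 1) =
      G.ballVolume o r + ∑ x ∈ (G.sphere_finite o (r + 1)).toFinset, G.m x := by
  classical
  rw [ballVolume, ballVolume, tsum_coe_of_finite (G.ball_finite o r),
    tsum_coe_of_finite (G.ball_finite o (r + 1)), ← Finset.sum_union]
  · refine Finset.sum_congr ?_ fun _ _ => rfl
    ext x
    simp only [Set.Finite.mem_toFinset, Finset.mem_union, ball, sphere, Set.mem_ofPred_eq]
    omega
  · refine Finset.disjoint_left.2 fun x hx hx' => ?_
    simp only [Set.Finite.mem_toFinset, ball, sphere, Set.mem_ofPred_eq] at hx hx'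
    omega

lemma ballVolume_pos (o : V) (r : ℕ) : 0 < G.ballVolume o r := by
  rw [ballVolume, tsum_coe_of_finite (G.ball_finite o r)]
  refine Finset.sum_pos (fun x _ => G.m_pos x) ⟨o, (G.ball_finite o r).mem_toFinset.2 ?_⟩
  simp [ball, dist_root]

/-- If `∑ V₁(r) / ∂B(r) = a`, the tails of the series form a positive decreasing function `g`
with `L g = 1`. -/
lemma HasRadialCurvature.exists_radial_eq_one [Infinite V] {o : V} {kp km : ℕ → ℝ}
    (h : G.HasRadialCurvature o kp km) {a : ℝ}
    (ha : HasSum (fun r : ℕ => G.ballVolume o r / G.ballBoundary o r) a) :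
    ∃ g : ℕ → ℝ, g 0 = a ∧ (∀ r, 0 < g r) ∧ Antitone g ∧ Tendsto g atTop (𝓝 0) ∧
      ∀ r, kp r * (g r - g (r + 1)) + km r * (g r - g (r - 1)) = 1 := by
  set t : ℕ → ℝ := fun r => G.ballVolume o r / G.ballBoundary o r with ht
  have hB : ∀ r, 0 < G.ballBoundary o r := fun r => by
    rw [h.ballBoundary_eq]
    exact mul_pos (h.outer_pos r) (sum_sphere_pos o r)
  have htpos : ∀ r, 0 < t r := fun r => div_pos (ballVolume_pos o r) (hB r)
  have hsum : ∀ r, Summable fun k => t (k + r) := fun r => (summable_nat_add_iff r).2 ha.summable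
  have hstep : ∀ r, (∑' k, t (k + r)) = t r + ∑' k, t (k + (r + 1)) := fun r => by
    rw [(hsum r).tsum_eq_zero_add]
    simp only [Nat.zero_add, Nat.add_assoc, Nat.add_comm 1 r]
  -- Here `g` is the tail of the series from `r` on, so `g(r) - g(r+1) = t(r)`.
  refine ⟨fun r => ∑' k, t (k + r), ha.tsum_eq, fun r => ?_, ?_, tendsto_sum_nat_add t,
    fun r => ?_⟩
  · exact (hsum r).tsum_pos (fun k => (htpos _).le) 0 (htpos _)
  · exact antitone_nat_of_succ_le fun r => by linarith [hstep r, htpos r]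
  · have h1 : (∑' k, t (k + r)) - ∑' k, t (k + (r + 1)) = t r := by linarith [hstep r]
    have hkt : ∀ r, kp r * t r * ∑ x ∈ (G.sphere_finite o r).toFinset, G.m x =
        G.ballVolume o r := fun r => by
      rw [mul_right_comm, ← h.ballBoundary_eq, ht, mul_div_cancel₀ _ (hB r).ne']
    have hs := sum_sphere_pos (G := G) o r
    -- After multiplication by `m(S_r)` the outer term is `V₁(r)` and, for `r > 0`, the inner one is
    -- `-V₁(r-1)`; their sum is `m(S_r)`.
    refine mul_right_cancel₀ hs.ne' ?_
    simp only [h1, add_mul, one_mul, hkt]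
    cases r with
    | zero => simp [ballVolume_zero]
    | succ r =>
      have h2 : (∑' k, t (k + (r + 1))) - ∑' k, t (k + r) = -t r := by linarith [hstep r]
      have h3 : km (r + 1) * t r * ∑ x ∈ (G.sphere_finite o (r + 1)).toFinset, G.m x =
          G.ballVolume o r := by
        rw [mul_right_comm, ← h.ballBoundary_eq', ht, mul_div_cancel₀ _ (hB r).ne']
      rw [Nat.add_sub_cancel, h2, mul_neg, neg_mul, h3, ballVolume_succ]
      ring

end

section

variable {V : Type*} (G : WeightedGraph V)

/-! ### Purely discrete spectrum -/

/-- Restriction of functions in `ℓ²(V, m)` to a finite set. -/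
def L2.restrict (S : Finset V) : G.L2 →L[ℝ] (S → ℝ) where
  toFun f x := f x
  map_add' _ _ := rfl
  map_smul' _ _ := rfl
  cont := continuous_pi fun x => L2.continuous_apply (x : V)

open Classical in
/-- Extension by zero of functions on a finite set. -/
def L2.extend (S : Finset V) : (S → ℝ) →ₗ[ℝ] G.L2 where
  toFun c := L2.ofFinite G (fun x => if h : x ∈ S then c ⟨x, h⟩ else 0)
    (S.finite_toSet.subset fun x hx => by
      by_contra h
      exact hx (dif_neg h))
  map_add' c d := L2.ext fun x => by
    change (if h : x ∈ S then c ⟨x, h⟩ + d ⟨x, h⟩ else 0) =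
      (if h : x ∈ S then c ⟨x, h⟩ else 0) + (if h : x ∈ S then d ⟨x, h⟩ else 0)
    split_ifs <;> simp
  map_smul' a c := L2.ext fun x => by
    change (if h : x ∈ S then a * c ⟨x, h⟩ else 0) = a * (if h : x ∈ S then c ⟨x, h⟩ else 0)
    split_ifs <;> simp

/-- Functions in the form domain are, relative to their energy, uniformly small outside of finite
sets. -/
def EnergyTight : Prop := ∀ ε > 0, ∃ S : Finset V, ∀ u : G.FormSpace,
  ‖FormSpace.incl G u - L2.extend G S (L2.restrict G S (FormSpace.incl G u))‖ ^ 2 ≤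
    ε * G.energy (FormSpace.incl G u) (FormSpace.incl G u)

variable {G}

lemma L2.sub_extend_restrict_apply_of_mem {S : Finset V} (f : G.L2) {x : V} (h : x ∈ S) :
    (f - L2.extend G S (L2.restrict G S f)) x = 0 :=
  (congrArg (f x - ·) (dif_pos h)).trans (sub_self _)

lemma L2.sub_extend_restrict_apply_of_notMem {S : Finset V} (f : G.L2) {x : V} (h : x ∉ S) :
    (f - L2.extend G S (L2.restrict G S f)) x = f x :=
  (congrArg (f x - ·) (dif_neg h)).trans (sub_zero _)

/-- A Hardy inequality with a weight tending to infinity implies tightness. -/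
lemma energyTight_of_hardy {x₀ : V} {g : ℕ → ℝ} (hg : ∀ r, 0 < g r) (hg' : Antitone g)
    (hlim : Tendsto g atTop (𝓝 0))
    (h : ∀ φ : V → ℝ, (Function.support φ).Finite →
      ∑' x, 1 / g (G.dist x x₀) * φ x ^ 2 * G.m x ≤ G.energy φ φ) : G.EnergyTight := by
  intro ε hε
  -- Outside the ball of radius `R` the weight satisfies `1/g ≥ 1/ε`.
  obtain ⟨R, hR⟩ := (hlim.eventually (gt_mem_nhds hε)).exists
  refine ⟨(G.ball_finite x₀ R).toFinset, fun u => ?_⟩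
  obtain ⟨hs, hle⟩ := u.tsum_weight_le_energy (w := fun x => 1 / g (G.dist x x₀))
    (fun x => (one_div_pos.2 (hg _)).le) h
  refine le_trans ?_ (mul_le_mul_of_nonneg_left hle hε.le)
  rw [L2.norm_sq, ← tsum_mul_left]
  refine Summable.tsum_le_tsum (fun x => ?_) (L2.summable_sq _) (hs.mul_left ε)
  have hm := G.m_pos x
  have hgx := hg (G.dist x x₀)
  by_cases hx : x ∈ (G.ball_finite x₀ R).toFinset
  · rw [L2.sub_extend_restrict_apply_of_mem _ hx]
    have : 0 ≤ ε * (1 / g (G.dist x x₀) * FormSpace.incl G u x ^ 2 * G.m x) := by positivity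
    simpa using this
  · rw [L2.sub_extend_restrict_apply_of_notMem _ hx]
    have hxR : ¬ G.dist x x₀ ≤ R := fun h0 => hx ((G.ball_finite x₀ R).mem_toFinset.2 h0)
    have h1 : g (G.dist x x₀) ≤ ε := (hg' (by omega)).trans hR.le
    have h2 : 1 ≤ ε * (1 / g (G.dist x x₀)) := by
      rw [mul_one_div, le_div_iff₀ hgx, one_mul]
      exact h1
    have h3 : 0 ≤ FormSpace.incl G u x ^ 2 * G.m x := by positivity
    have h4 := mul_le_mul_of_nonneg_right h2 h3
    linarith

lemma energy_laplacian (f g : G.laplacian.domain) :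
    G.energy (f : G.L2) (g : G.L2) = inner ℝ (G.laplacian f) (g : G.L2) :=
  (laplacian_mem_graph f).2 _ (laplacian_mem_graph g).1

lemma EnergyTight.norm_le (h : G.EnergyTight) {ε : ℝ} (hε : 0 < ε) :
    ∃ S : Finset V, ∀ f : G.laplacian.domain,
      ‖(f : G.L2) - L2.extend G S (L2.restrict G S (f : G.L2))‖ ^ 2 ≤
        ε * inner ℝ (G.laplacian f) (f : G.L2) := by
  obtain ⟨S, hS⟩ := h ε hε
  refine ⟨S, fun f => ?_⟩
  have h1 := hS (FormSpace.mk f (laplacian_mem_graph f).1)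
  rw [FormSpace.incl_mk, energy_laplacian] at h1
  exact h1

/-- For bounded energy ratio, elements of the operator domain are determined on a finite set. -/
lemma EnergyTight.exists_finset (h : G.EnergyTight) (M : ℝ) :
    ∃ S : Finset V, ∀ f : G.laplacian.domain,
      inner ℝ (G.laplacian f) (f : G.L2) ≤ M * ‖(f : G.L2)‖ ^ 2 →
      L2.restrict G S (f : G.L2) = 0 → f = 0 := by
  have hM : 0 < |M| + 1 := by positivity
  obtain ⟨S, hS⟩ := h.norm_le (ε := 1 / (|M| + 1)) (by positivity)
  refine ⟨S, fun f hf h0 => ?_⟩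
  have h1 := hS f
  rw [h0, map_zero, sub_zero, one_div_mul_eq_div, le_div_iff₀ hM] at h1
  have h2 : ‖(f : G.L2)‖ ^ 2 = 0 := by
    nlinarith [le_abs_self M, sq_nonneg ‖(f : G.L2)‖]
  exact Subtype.ext (by simpa using h2)

/-- Here `K` is `L⁻¹`. Cutting `Kg` off to a finite set gives finite-rank operators, and tightness
with `⟨LKg, Kg⟩ = ⟨g, Kg⟩ ≤ ‖K‖‖g‖²` makes them converge to `K` in norm. -/
lemma EnergyTight.isCompactOperator (h : G.EnergyTight) {K : G.L2 →L[ℝ] G.L2}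
    (hK : ∀ g : G.L2, ∃ f : G.laplacian.domain, K g = f ∧ G.laplacian f = g) :
    IsCompactOperator K := by
  refine isClosed_setOfPred_isCompactOperator.closure_subset
    (Metric.mem_closure_iff.2 fun ε hε => ?_)
  have hK0 : 0 < ‖K‖ + 1 := by positivity
  obtain ⟨S, hS⟩ := h.norm_le (ε := (ε / 2) ^ 2 / (‖K‖ + 1)) (by positivity)
  let E : (S → ℝ) →L[ℝ] G.L2 := (L2.extend G S).toContinuousLinearMap
  let F : G.L2 →L[ℝ] (S → ℝ) := L2.restrict G S ∘L K
  have hF : IsCompactOperator F := isCompactOperator_of_locallyCompactSpace_dom F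
  refine ⟨E ∘L F, hF.clm_comp E, ?_⟩
  rw [dist_eq_norm]
  refine lt_of_le_of_lt (ContinuousLinearMap.opNorm_le_bound _ (half_pos hε).le fun g => ?_)
    (half_lt_self hε)
  obtain ⟨f, h1, h2⟩ := hK g
  have h3 := hS f
  rw [h2, ← h1] at h3
  refine le_of_sq_le_sq ?_ (by positivity)
  change ‖K g - L2.extend G S (L2.restrict G S (K g))‖ ^ 2 ≤ _
  refine h3.trans ?_
  have h4 : inner ℝ g (K g) ≤ (‖K‖ + 1) * ‖g‖ ^ 2 := by
    refine (real_inner_le_norm _ _).trans ?_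
    have := K.le_opNorm g
    nlinarith [norm_nonneg g]
  calc (ε / 2) ^ 2 / (‖K‖ + 1) * inner ℝ g (K g)
      ≤ (ε / 2) ^ 2 / (‖K‖ + 1) * ((‖K‖ + 1) * ‖g‖ ^ 2) :=
        mul_le_mul_of_nonneg_left h4 (by positivity)
    _ = (ε / 2 * ‖g‖) ^ 2 := by
      field_simp

/-- Fredholm alternative for the compact `K = L⁻¹`: either `1/μ` is an eigenvalue of `K`, hence `μ`
one of `L`, or `U = μ⁻¹ - K` is invertible. In the latter case `L - μ = U μ L` has the bounded
inverse `μ⁻¹ K U⁻¹`. -/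
lemma EnergyTight.exists_eigenvector (h : G.EnergyTight) {c : ℝ} (hc : 0 < c)
    (hb : G.FormBoundedBelow c) {μ : ℝ} (hμ : μ ∈ G.laplacian.spectrum) :
    ∃ f : G.laplacian.domain, f ≠ 0 ∧ G.laplacian f = μ • (f : G.L2) := by
  have h0 : (0 : ℝ) ∈ G.laplacian.resolventSet := mem_resolventSet_of_lt hc.le hb hc
  have hμ0 : μ ≠ 0 := fun h1 => hμ (h1 ▸ h0)
  obtain ⟨K, hKL, hK⟩ := h0
  simp only [zero_smul, sub_zero] at hKL hK
  by_contra hne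
  push Not at hne
  have hKμ : μ⁻¹ ∈ _root_.resolventSet ℝ K := by
    refine ((h.isCompactOperator hK).hasEigenvalue_or_mem_resolventSet
      (inv_ne_zero hμ0)).resolve_left fun hev => ?_
    obtain ⟨v, hv⟩ := hev.exists_hasEigenvector
    have hv1 : K v = μ⁻¹ • v := hv.apply_eq_smul
    obtain ⟨f, h1, h2⟩ := hK v
    refine hne f (fun hf => hv.2 ?_) ?_
    · rw [← h2, hf, LinearPMap.map_zero]
    · rw [h2, ← h1, hv1, smul_smul, mul_inv_cancel₀ hμ0, one_smul]
  obtain ⟨U, hU⟩ := spectrum.mem_resolventSet_iff.1 hKμ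
  have hUapp : ∀ g : G.L2, (U : G.L2 →L[ℝ] G.L2) g = μ⁻¹ • g - K g := fun g => by
    rw [hU]
    simp [Algebra.algebraMap_eq_smul_one]
  have hinv1 : ∀ g : G.L2, (↑U⁻¹ : G.L2 →L[ℝ] G.L2) ((U : G.L2 →L[ℝ] G.L2) g) = g := fun g =>
    congrArg (fun T : G.L2 →L[ℝ] G.L2 => T g) U.inv_mul
  have hinv2 : ∀ g : G.L2, (U : G.L2 →L[ℝ] G.L2) ((↑U⁻¹ : G.L2 →L[ℝ] G.L2) g) = g := fun g =>
    congrArg (fun T : G.L2 →L[ℝ] G.L2 => T g) U.mul_inv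
  refine hμ ⟨μ⁻¹ • (K ∘L (↑U⁻¹ : G.L2 →L[ℝ] G.L2)), fun f => ?_, fun g => ?_⟩
  · have h1 : G.laplacian f - μ • (f : G.L2) = (U : G.L2 →L[ℝ] G.L2) (μ • G.laplacian f) := by
      rw [hUapp, map_smul, hKL, smul_smul, inv_mul_cancel₀ hμ0, one_smul]
    change μ⁻¹ • K ((↑U⁻¹ : G.L2 →L[ℝ] G.L2) _) = _
    rw [h1, hinv1, map_smul, hKL, smul_smul, inv_mul_cancel₀ hμ0, one_smul]
  · obtain ⟨f, h1, h2⟩ := hK (μ⁻¹ • (↑U⁻¹ : G.L2 →L[ℝ] G.L2) g)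
    refine ⟨f, by rw [← h1, map_smul]; rfl, ?_⟩
    rw [h2, ← h1, map_smul, smul_smul, mul_inv_cancel₀ hμ0, one_smul, ← hUapp, hinv2]

lemma inner_eq_zero_of_eigenvectors {f g : G.laplacian.domain} {μ ν : ℝ} (hμν : μ ≠ ν)
    (hf : G.laplacian f = μ • (f : G.L2)) (hg : G.laplacian g = ν • (g : G.L2)) :
    inner ℝ (f : G.L2) (g : G.L2) = 0 := by
  have h1 := energy_laplacian f g
  have h2 := energy_laplacian g f
  rw [energy_comm, h1, hf, hg, real_inner_smul_left, real_inner_smul_left,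
    real_inner_comm (f : G.L2)] at h2
  have h3 : (μ - ν) * inner ℝ (f : G.L2) (g : G.L2) = 0 := by linarith
  exact (mul_eq_zero.1 h3).resolve_left (sub_ne_zero.2 hμν)

lemma inner_sum_smul_sum_smul {ι E : Type*} [NormedAddCommGroup E] [InnerProductSpace ℝ E]
    {v : ι → E} (ho : Pairwise fun i j => inner ℝ (v i) (v j) = 0) (s : Finset ι) (a b : ι → ℝ) :
    inner ℝ (∑ i ∈ s, a i • v i) (∑ i ∈ s, b i • v i) = ∑ i ∈ s, a i * b i * ‖v i‖ ^ 2 := by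
  rw [sum_inner]
  refine Finset.sum_congr rfl fun i hi => ?_
  rw [inner_sum, Finset.sum_eq_single_of_mem i hi]
  · rw [real_inner_smul_left, real_inner_smul_right, real_inner_self_eq_norm_sq]
    ring
  · intro j _ hj
    rw [real_inner_smul_left, real_inner_smul_right, ho hj.symm]
    simp

/-- Eigenvectors for distinct eigenvalues are orthogonal, so every `w` in the span of those with `ν
≤ M` satisfies `⟨Lw,w⟩ ≤ M‖w‖²` and is determined by its values on one finite set. Hence there are
only finitely many. -/
lemma EnergyTight.finite_eigenvalues (h : G.EnergyTight) (M : ℝ) :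
    {ν : ℝ | ν ≤ M ∧ ∃ f : G.laplacian.domain, f ≠ 0 ∧
      G.laplacian f = ν • (f : G.L2)}.Finite := by
  set A := {ν : ℝ | ν ≤ M ∧ ∃ f : G.laplacian.domain, f ≠ 0 ∧
    G.laplacian f = ν • (f : G.L2)} with hA
  choose v hv0 hv using fun ν : A => ν.2.2
  have ho : Pairwise fun i j : A => inner ℝ (v i : G.L2) (v j : G.L2) = 0 := fun i j hij =>
    inner_eq_zero_of_eigenvectors (fun h0 => hij (Subtype.ext h0)) (hv i) (hv j)
  have hlin : LinearIndependent ℝ fun i : A => (v i : G.L2) :=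
    linearIndependent_of_ne_zero_of_inner_eq_zero
      (fun i h0 => hv0 i (Subtype.ext h0)) ho
  obtain ⟨S, hS⟩ := h.exists_finset M
  have hlin' : LinearIndependent ℝ fun i : A => L2.restrict G S (v i : G.L2) := by
    rw [linearIndependent_iff'] at hlin ⊢
    intro s a ha
    refine hlin s a ?_
    set w : G.laplacian.domain := ∑ i ∈ s, a i • v i with hw
    have hwc : (w : G.L2) = ∑ i ∈ s, a i • (v i : G.L2) := by
      simp [hw]
    have hLw : G.laplacian w = ∑ i ∈ s, (a i * (i : ℝ)) • (v i : G.L2) := by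
      rw [hw, ← LinearPMap.toFun_eq_coe, map_sum]
      refine Finset.sum_congr rfl fun i _ => ?_
      rw [map_smul, LinearPMap.toFun_eq_coe, hv, smul_smul]
    have hw0 := hS w ?_ ?_
    · rw [← hwc, hw0]
      rfl
    · rw [hLw, ← real_inner_self_eq_norm_sq, hwc, inner_sum_smul_sum_smul ho,
        inner_sum_smul_sum_smul ho, Finset.mul_sum]
      refine Finset.sum_le_sum fun i _ => ?_
      have h1 := mul_le_mul_of_nonneg_right i.2.1
        (mul_nonneg (mul_self_nonneg (a i)) (sq_nonneg ‖(v i : G.L2)‖))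
      linarith
    · rw [hwc, map_sum]
      simpa using ha
  exact Set.finite_coe_iff.1 hlin'.finite

lemma EnergyTight.spectrum_eq_discreteSpectrum (h : G.EnergyTight) {c : ℝ} (hc : 0 < c)
    (hb : G.FormBoundedBelow c) : G.laplacian.spectrum = G.laplacian.discreteSpectrum := by
  refine Set.Subset.antisymm (fun μ hμ => ⟨hμ, ?_, ?_, ?_⟩) fun μ hμ => hμ.1
  · have hfin := (h.finite_eigenvalues (μ + 1)).subset (Set.sdiff_subset (t := {μ}))
    obtain ⟨ε, hε, hball⟩ := Metric.isOpen_iff.1 hfin.isClosed.isOpen_compl μ (by simp)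
    refine ⟨min ε 1, lt_min hε one_pos, fun ν hν hνμ => ?_⟩
    by_contra hne
    refine hball (a := ν) (lt_of_lt_of_le hνμ (min_le_left _ _)) ⟨⟨?_, ?_⟩, hne⟩
    · linarith [le_abs_self (ν - μ), min_le_right ε 1]
    · exact h.exists_eigenvector hc hb hν
  · obtain ⟨f, hf0, hf⟩ := h.exists_eigenvector hc hb hμ
    refine (Submodule.ne_bot_iff _).2 ⟨f, ?_, hf0⟩
    exact LinearMap.mem_ker.2 (sub_eq_zero.2 hf)
  · obtain ⟨S, hS⟩ := h.exists_finset μ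
    let T : G.laplacian.eigenspace μ →ₗ[ℝ] (S → ℝ) :=
      (L2.restrict G S : G.L2 →ₗ[ℝ] (S → ℝ)) ∘ₗ G.laplacian.domain.subtype ∘ₗ
        (G.laplacian.eigenspace μ).subtype
    refine FiniteDimensional.of_injective T ((injective_iff_map_eq_zero T).2 fun f hf => ?_)
    have hfμ : G.laplacian (f : G.laplacian.domain) = μ • ((f : G.laplacian.domain) : G.L2) :=
      sub_eq_zero.1 (LinearMap.mem_ker.1 f.2)
    refine Subtype.ext (hS f ?_ hf)
    rw [hfμ, real_inner_smul_left, real_inner_self_eq_norm_sq]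

end

end WeightedGraph

end

/-! ### The comparison theorem. -/

theorem theoremt {V W : Type*} [Countable V] [Infinite V] [Countable W] [Infinite W]
    (G : WeightedGraph V) (x₀ : V) (Gs : WeightedGraph W) (o : W)
    (hs : Gs.WeaklySphericallySymmetric o) :
    (G.StrongerCurvatureGrowth x₀ Gs o →
      Gs.laplacian.bottomOfSpectrum ≤ G.laplacian.bottomOfSpectrum) ∧
    (G.WeakerCurvatureGrowth x₀ Gs o →
      G.laplacian.bottomOfSpectrum ≤ Gs.laplacian.bottomOfSpectrum) ∧
    (∀ a : ℝ, HasSum (fun r : ℕ => Gs.ballVolume o r / Gs.ballBoundary o r) a →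
      G.StrongerCurvatureGrowth x₀ Gs o →
      ((1 / a : ℝ) : EReal) ≤ G.laplacian.bottomOfSpectrum ∧
      G.laplacian.spectrum = G.laplacian.discreteSpectrum) := by
  obtain ⟨⟨kp, hkp⟩, ⟨km, hkm⟩⟩ := hs
  have hr : Gs.HasRadialCurvature o kp km := ⟨hkp, hkm⟩
  have hstrong : G.StrongerCurvatureGrowth x₀ Gs o → ∀ x,
      kp (G.dist x x₀) ≤ G.outerCurvature x₀ x ∧ G.innerCurvature x₀ x ≤ km (G.dist x x₀) := by
    rintro ⟨-, h⟩ x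
    -- A vertex of the symmetric graph at the same radius is needed to read off the profile there;
    -- it exists since `W` is infinite.
    obtain ⟨y, hy⟩ := Gs.sphere_nonempty o (G.dist x x₀)
    have h1 := h _ x rfl y hy
    rwa [hkp, hkm, show Gs.dist y o = G.dist x x₀ from hy] at h1
  refine ⟨fun h => ?_, fun h => ?_, fun a ha h => ?_⟩
  · exact WeightedGraph.bottomOfSpectrum_le_of_curvature hr.outer_pos hr.inner_nonneg
      (fun y => (hkp y).le) (fun y => (hkm y).ge)
      (fun x => (hstrong h x).1) (fun x => (hstrong h x).2)
  · have hweak : ∀ x,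
        G.outerCurvature x₀ x ≤ kp (G.dist x x₀) ∧ km (G.dist x x₀) ≤ G.innerCurvature x₀ x := by
      intro x
      obtain ⟨y, hy⟩ := Gs.sphere_nonempty o (G.dist x x₀)
      have h1 := h.2 _ x rfl y hy
      rwa [hkp, hkm, show Gs.dist y o = G.dist x x₀ from hy] at h1
    exact WeightedGraph.bottomOfSpectrum_le_of_curvature hr.outer_pos hr.inner_nonneg
      (fun x => (hweak x).1) (fun x => (hweak x).2)
      (fun y => (hkp y).ge) (fun y => (hkm y).le)
  · obtain ⟨g, hg0, hg, hanti, hlim, hgeq⟩ := hr.exists_radial_eq_one ha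
    have ha0 : 0 < a := hg0 ▸ hg 0
    -- The constant weight is admissible because `g ≤ g(0) = a` gives `g/a ≤ 1 = Lg` for the
    -- profile.
    have hb : G.FormBoundedBelow (1 / a) := fun φ hφ =>
      WeightedGraph.weight_le_energy_of_radial (w := fun _ => 1 / a) hg hanti (fun r => by
        rw [hgeq, one_div_mul_eq_div, div_le_one ha0, ← hg0]
        exact hanti (Nat.zero_le r))
        (fun x => (hstrong h x).1) (fun x => (hstrong h x).2) hφ
    have ht : G.EnergyTight := WeightedGraph.energyTight_of_hardy hg hanti hlim fun φ hφ =>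
      WeightedGraph.weight_le_energy_of_radial (w := fun r => 1 / g r) hg hanti (fun r => by
        rw [hgeq, one_div_mul_cancel (hg r).ne'])
        (fun x => (hstrong h x).1) (fun x => (hstrong h x).2) hφ
    exact ⟨WeightedGraph.le_bottomOfSpectrum hb, ht.spectrum_eq_discreteSpectrum (one_div_pos.2 ha0) hb⟩
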